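/- **Setting.** Fix real constants $\epsilon,\delta$ with $\gamma^2:=\epsilon+\delta^2\neq 0$, where $\gamma>0$ if $\gamma^2>0$ and $\gamma\in i\mathbb R_{>0}$ if $\gamma^2<0$. A CMC-$\delta$ surface in the 3-dimensional space form of curvature $\epsilon$ is given by its Bonnet data: a Riemann surface $\Sigma$ with a smooth conformal metric $e^{2u}|dz|^2$ and a holomorphic quadratic differential (Hopf differential) $\mathrm{II}=Q\,dz^2$ satisfying the Gauss equation $R=\gamma^2-|Q|^2e^{-4u}$, where $R=-4e^{-2u}u_{z\bar z}$. The double cover $\nu:\hat\Sigma\to\Sigma$ defined by $\mathrm{II}$ is the normalization of the curve $\{\kappa\in K_\Sigma:\kappa^2=\mathrm{II}\}$, assuming that $\mathrm{II}$ is not identically zero. It carries the tautological holomorphic 1-form $\omega$ with $\omega^2=\nu^*\mathrm{II}$, and $\hat K$ is its canonical bundle. **Conservation laws.** Let $\xi$ be a local $(1,0)$-form of unit length, write $\mathrm{II}=h_2\xi^2$, choose $h_2^{1/2}$ so that $\omega=h_2^{1/2}\xi$, and let $\rho$ be the real 1-form with $d\xi=i\rho\wedge\xi$. For a function $f$ of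 weight $k$ let $\partial_\xi f$ be the $\xi$-coefficient of $df+ikf\rho$; here $h_2$ has weight $2$, and $a^{2n+1},b^{2n},c^{2n}$ below have weights $0,-1,1$. Set $h_3=\partial_\xi h_2$. The formal Killing coefficients are $a^1=b^0=c^0=0$, $a^3=h_2^{-3/2}h_3$, $b^2=-i\gamma h_2^{-1/2}$, $c^2=ih_2^{1/2}$, and for $n\ge1$ $$b^{2n+2}=\tfrac{i}{2h_2}\big(-\partial_\xi a^{2n+1}-\tfrac12h_2^{1/2}\hat m_n\big),\quad c^{2n+2}=\tfrac{i}{2\gamma}\big(-\partial_\xi a^{2n+1}+\tfrac12h_2^{1/2}\hat m_n\big),\quad a^{2n+3}=-2ih_2^{-1}\partial_\xi c^{2n+2}.$$ Here $\hat a_{ij}=a^{2i+1}a^{2j+3}-2b^{2i+2}c^{2j+2}-2b^{2j+2}c^{2i+2}$ and $\hat s_n=\sum_{i+j=n,\,1\le i\le j}\hat a_{ij}$. For even $n$, $\hat m_n=\hat s_n+\frac12(-\hat a_{n/2,n/2}+a^{n+1}a^{n+3})$; for odd $n$, $\hat m_n=\hat s_n+\frac12(a^{n+2})^2$. The higher-order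 conservation laws are the 1-forms $$\varphi_n=c^{2n+2}\xi+b^{2n}\bar\xi,\qquad n\ge0,$$ defined on $\hat\Sigma$ away from the zeros of $\omega$. **Normal form at an umbilic.** Let $z$ be a local coordinate adapted to an umbilic of degree $p\ge1$: it is centered at the umbilic and $\mathrm{II}=z^p\,dz^2$. Take $\xi=e^u\,dz$, put $z=w^2$, and take $h_2^{1/2}=e^{-u}w^p$, so that $\omega=2w^{p+1}dw$. Let $\mathcal O(w^\ell)$ denote a polynomial in $w$ of degree $\le\ell$ (zero if $\ell<0$) whose coefficients are polynomials in $e^{u},e^{-u}$ and the derivatives $u_k=\partial_z^ku$, $k\ge1$. These polynomials depend only on $n,p,\epsilon,\delta$, and not on the surface or the coordinate. Then for $w\ne0$ in the coordinate domain $$b^{2n}=\frac{\mathcal O(w^{4n-4})}{w^{(2n-1)p+4n-4}},\qquad c^{2n}=\frac{\mathcal O(w^{4n-4})}{w^{(2n-3)p+4n-4}},\qquad a^{2n+1}=\frac{\mathcal O(w^{4n-2})}{w^{(2n-1)p+4n-2}}\qquad(n\ge1),$$ $$\varphi_n=\frac{\mathcal O(w^{4n})}{w^{(2n-1)p+4n-1}}\,dw+\frac{\mathcal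 O(w^{4n-4})}{w^{(2n-1)p+4n-4}}\,\bar w\,d\bar w\qquad(n\ge0).$$ **Smoothness.** For every $n\ge0$ the form $\varphi_n\otimes\omega^{4n}$ is a smooth section of $\Omega^1(\hat\Sigma)\otimes\hat K^{4n}$; that is, it extends smoothly across the zeros of $\omega$ to all of $\hat\Sigma$. -/

import Mathlib

open scoped Manifold ContDiff Topology ComplexConjugate

noncomputable section

namespace CMCUmbilic

/-! ### Calculus in one complex variable -/

/-- The Wirtinger derivative `∂f/∂z` of a (real-differentiable) function `f : ℂ → ℂ`. -/
def dz (f : ℂ → ℂ) (z : ℂ) : ℂ :=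
  (fderiv ℝ f z 1 - Complex.I * fderiv ℝ f z Complex.I) / 2

/-- The Wirtinger derivative `∂f/∂z̄`. -/
def dzbar (f : ℂ → ℂ) (z : ℂ) : ℂ :=
  (fderiv ℝ f z 1 + Complex.I * fderiv ℝ f z Complex.I) / 2

/-- The `k`-th `z`-derivative `u_k = ∂ᵏu/∂zᵏ` of a real valued function `u`. -/
def uDer (u : ℂ → ℝ) (k : ℕ) : ℂ → ℂ := dz^[k] (fun z => (u z : ℂ))

/-! ### Riemann surfaces and differentials

A Riemann surface is a manifold modelled on `ℂ` with holomorphic transition maps. -/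

/-- The holomorphic local coordinates of a Riemann surface: its maximal holomorphic atlas. -/
def Charts (X : Type*) [TopologicalSpace X] [ChartedSpace ℂ X] :
    Set (OpenPartialHomeomorph X ℂ) :=
  IsManifold.maximalAtlas 𝓘(ℂ) ω X

/-- A section (with no regularity imposed) of the line bundle `K^r ⊗ K̄^s` on `X`. In a local
coordinate `z = e` it is written `coeff e (z) (dz)^r (dz̄)^s`; the values of `coeff e` outside of
`e.target` carry no information. -/
structure Differential (X : Type*) [TopologicalSpace X] [ChartedSpace ℂ X] (r s : ℕ) where
  coeff : OpenPartialHomeomorph X ℂ → ℂ → ℂ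
  transform : ∀ e ∈ Charts X, ∀ e' ∈ Charts X, ∀ x ∈ e.source, x ∈ e'.source →
    coeff e (e x) = coeff e' (e' x) * deriv (fun z => e' (e.symm z)) (e x) ^ r *
      conj (deriv (fun z => e' (e.symm z)) (e x)) ^ s

namespace Differential

variable {X : Type*} [TopologicalSpace X] [ChartedSpace ℂ X] {r s : ℕ}

/-- `C^∞` sections. -/
def IsSmooth (D : Differential X r s) : Prop :=
  ∀ e ∈ Charts X, ContDiffOn ℝ ∞ (D.coeff e) e.target

/-- Holomorphic sections. -/
def IsHolomorphic (D : Differential X r s) : Prop :=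
  ∀ e ∈ Charts X, DifferentiableOn ℂ (D.coeff e) e.target

/-- Vanishing of a section at a point. -/
def VanishesAt (D : Differential X r s) (x : X) : Prop :=
  ∀ e ∈ Charts X, x ∈ e.source → D.coeff e (e x) = 0

end Differential

/-- A section of `Ω¹(X) ⊗ K^m`, where `Ω¹` are the complex valued 1-forms: locally
`(A dz + B dz̄) ⊗ (dz)^m`, that is, a section of `K^(m+1) ⊕ (K^m ⊗ K̄)`. -/
structure TwistedOneForm (X : Type*) [TopologicalSpace X] [ChartedSpace ℂ X] (m : ℕ) where
  dzPart : Differential X (m + 1) 0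
  dzbarPart : Differential X m 1

/-- `C^∞` sections of `Ω¹(X) ⊗ K^m`. -/
def TwistedOneForm.IsSmooth {X : Type*} [TopologicalSpace X] [ChartedSpace ℂ X] {m : ℕ}
    (σ : TwistedOneForm X m) : Prop :=
  σ.dzPart.IsSmooth ∧ σ.dzbarPart.IsSmooth

/-! ### CMC surfaces -/

/-- The structure constant `γ` of CMC-`δ` surfaces in the space form of curvature `ε`:
`γ² = ε + δ²`, with `γ ≥ 0` or `γ ∈ i ℝ_{>0}`. -/
def gammaConst (ε δ : ℝ) : ℂ :=
  if 0 ≤ ε + δ ^ 2 then (Real.sqrt (ε + δ ^ 2) : ℂ)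
  else Complex.I * (Real.sqrt (-(ε + δ ^ 2)) : ℂ)

/-- A CMC-`δ` surface in the 3-dimensional space form of curvature `ε`, given by its Bonnet data
on the Riemann surface `X`: a conformal metric `e^{2u}|dz|²` and a holomorphic quadratic
differential (the Hopf differential) `Q (dz)²`, subject to the Gauss equation
`R = γ² - |Q|² e^{-4u}`, where `R = -4 e^{-2u} u_{z z̄}` is the Gauss curvature of the metric and
`γ² = ε + δ²`. -/
structure CMCSurface (ε δ : ℝ) (X : Type*) [TopologicalSpace X] [ChartedSpace ℂ X] where
  metric : Differential X 1 1
  metric_smooth : metric.IsSmooth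
  metric_pos : ∀ e ∈ Charts X, ∀ z ∈ e.target, ∃ l : ℝ, 0 < l ∧ metric.coeff e z = (l : ℂ)
  hopf : Differential X 2 0
  hopf_holomorphic : hopf.IsHolomorphic
  gauss : ∀ e ∈ Charts X, ∀ z ∈ e.target,
    -4 / metric.coeff e z *
        dz (dzbar (fun y => ((Real.log (metric.coeff e y).re / 2 : ℝ) : ℂ))) z =
      ((ε + δ ^ 2 : ℝ) : ℂ) - ((‖hopf.coeff e z‖ ^ 2 : ℝ) : ℂ) / metric.coeff e z ^ 2

namespace CMCSurface

variable {ε δ : ℝ} {X : Type*} [TopologicalSpace X] [ChartedSpace ℂ X]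

/-- The real function `u` with metric `e^{2u}|dz|²` in the coordinate `z = e`. -/
def u (S : CMCSurface ε δ X) (e : OpenPartialHomeomorph X ℂ) (z : ℂ) : ℝ :=
  Real.log (S.metric.coeff e z).re / 2

/-- `z = e` is a local coordinate centered at a point and adapted to an umbilic of degree `p`
there: the Hopf differential is `z^p (dz)²`, so that for the frame `ξ = e^u dz` one has
`η₁ = e^{-u} z^p dz`. -/
def IsAdapted (S : CMCSurface ε δ X) (p : ℕ) (e : OpenPartialHomeomorph X ℂ) : Prop :=
  e ∈ Charts X ∧ (0 : ℂ) ∈ e.target ∧ ∀ z ∈ e.target, S.hopf.coeff e z = z ^ p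

end CMCSurface

/-- The double cover of a CMC surface `S` defined by the square root of its Hopf differential `II`:
the Riemann surface (normalization) `Y` of the curve `{κ ∈ K | κ² = II} ⊂ K`, with its projection
`proj` to `X` and its tautological 1-form `omega`, the square root of `II`.
A point `y` of `Y` lies over the point `κ` of the curve with `omega_y = proj^* κ`. -/
structure DoubleCover {ε δ : ℝ} {X : Type*} [TopologicalSpace X] [ChartedSpace ℂ X]
    (S : CMCSurface ε δ X) (Y : Type*) [TopologicalSpace Y] [ChartedSpace ℂ Y] where
  proj : Y → X
  proj_holomorphic : ContMDiff 𝓘(ℂ) 𝓘(ℂ) ω proj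
  proj_proper : IsProperMap proj
  omega : Differential Y 1 0
  omega_holomorphic : omega.IsHolomorphic
  /-- `omega² = proj^* II`. -/
  omega_sq : ∀ e' ∈ Charts Y, ∀ e ∈ Charts X, ∀ y ∈ e'.source, proj y ∈ e.source →
    omega.coeff e' (e' y) ^ 2 =
      S.hopf.coeff e (e (proj y)) * deriv (fun ζ => e (proj (e'.symm ζ))) (e' y) ^ 2
  /-- The points over the umbilics form a nowhere dense set. -/
  dense_regular : Dense {y : Y | ¬ S.hopf.VanishesAt (proj y)}
  /-- Away from the umbilics `Y` is the curve `{κ ∈ K | κ² = II}` itself. -/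
  regular_bijective : ∀ x : X, ¬ S.hopf.VanishesAt x → ∀ e ∈ Charts X, x ∈ e.source →
    ∀ κ : ℂ, κ ^ 2 = S.hopf.coeff e (e x) →
      ∃! y : Y, proj y = x ∧ ∀ e' ∈ Charts Y, y ∈ e'.source →
        omega.coeff e' (e' y) = κ * deriv (fun ζ => e (proj (e'.symm ζ))) (e' y)

/-! ### Formal Killing coefficients and higher-order conservation laws

Everything below is computed in a local holomorphic coordinate `ζ`, in terms of a (1,0)-form
`ξ = g dζ` of unit length and a choice `q` of the square root `h₂^{1/2}`, where the Hopf
differential is `II = h₂ ξ²`. -/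

/-- The covariant derivative `∂_ξ f` with respect to `ξ = g dζ` of a function `f` of weight `k`.
The connection form `ρ` is the real 1-form with `dξ = i ρ ∧ ξ`, i.e.
`i ρ = (g_ζ̄ / g) dζ̄ - conj (g_ζ̄ / g) dζ`, and `df + i k f ρ = (∂_ξ f) ξ + (∂_ξ̄ f) ξ̄`. -/
def dXi (g : ℂ → ℂ) (k : ℤ) (f : ℂ → ℂ) (ζ : ℂ) : ℂ :=
  (dz f ζ - (k : ℂ) * conj (dzbar g ζ / g ζ) * f ζ) / g ζ

/-- A triple `(a, b, c)` of functions; the `n`-th one is `(a^{2n+1}, b^{2n}, c^{2n})`. -/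
structure Triple where
  a : ℂ → ℂ
  b : ℂ → ℂ
  c : ℂ → ℂ

/-- `â_{ij} = a^{2i+1} a^{2j+3} - 2 b^{2i+2} c^{2j+2} - 2 b^{2j+2} c^{2i+2}`. -/
def aHat (T : ℕ → Triple) (i j : ℕ) (ζ : ℂ) : ℂ :=
  (T i).a ζ * (T (j + 1)).a ζ - 2 * (T (i + 1)).b ζ * (T (j + 1)).c ζ
    - 2 * (T (j + 1)).b ζ * (T (i + 1)).c ζ

/-- `ŝ_n`, the sum of the `â_{ij}` over `i + j = n`, `1 ≤ i ≤ j`. -/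
def sHat (T : ℕ → Triple) (n : ℕ) (ζ : ℂ) : ℂ :=
  ∑ ij ∈ (Finset.HasAntidiagonal.antidiagonal n).filter (fun ij => 1 ≤ ij.1 ∧ ij.1 ≤ ij.2), aHat T ij.1 ij.2 ζ

/-- `m̂_n = ŝ_n + (- â_{n/2,n/2} + a^{n+1} a^{n+3}) / 2` for even `n`, and
`m̂_n = ŝ_n + (a^{n+2})² / 2` for odd `n`. -/
def mHat (T : ℕ → Triple) (n : ℕ) (ζ : ℂ) : ℂ :=
  if Even n then
    sHat T n ζ + (- aHat T (n / 2) (n / 2) ζ + (T (n / 2)).a ζ * (T (n / 2 + 1)).a ζ) / 2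
  else sHat T n ζ + (T ((n + 1) / 2)).a ζ ^ 2 / 2

/-- The first triple `(a³, b², c²) = (h₂^{-3/2} h₃, -iγ h₂^{-1/2}, i h₂^{1/2})`, where
`h₃ = ∂_ξ h₂`. -/
def firstTriple (γ : ℂ) (g q : ℂ → ℂ) : Triple where
  a := fun ζ => dXi g 2 (fun y => q y ^ 2) ζ / q ζ ^ 3
  b := fun ζ => -Complex.I * γ / q ζ
  c := fun ζ => Complex.I * q ζ

/-- The inductive formulae
`b^{2n+2} = (i / 2h₂) (- ∂_ξ a^{2n+1} - h₂^{1/2} m̂_n / 2)`,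
`c^{2n+2} = (i / 2γ) (- ∂_ξ a^{2n+1} + h₂^{1/2} m̂_n / 2)`,
`a^{2n+3} = - 2i h₂^{-1} ∂_ξ c^{2n+2}`
(`a` has weight `0` and `c` has weight `1`). -/
def nextTriple (γ : ℂ) (g q : ℂ → ℂ) (T : ℕ → Triple) (n : ℕ) : Triple :=
  let c' : ℂ → ℂ := fun ζ =>
    Complex.I / (2 * γ) * (- dXi g 0 (T n).a ζ + q ζ * mHat T n ζ / 2)
  { a := fun ζ => -2 * Complex.I / q ζ ^ 2 * dXi g 1 c' ζ
    b := fun ζ => Complex.I / (2 * q ζ ^ 2) * (- dXi g 0 (T n).a ζ - q ζ * mHat T n ζ / 2)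
    c := c' }

/-- `killingTable γ g q N` lists the triples with index `≤ N`. The one of index `0` is
`(a¹, b⁰, c⁰) = (0, 0, 0)`. -/
def killingTable (γ : ℂ) (g q : ℂ → ℂ) : ℕ → ℕ → Triple
  | 0 => fun _ => ⟨0, 0, 0⟩
  | 1 => Function.update (fun _ => ⟨0, 0, 0⟩) 1 (firstTriple γ g q)
  | n + 2 => Function.update (killingTable γ g q (n + 1)) (n + 2)
      (nextTriple γ g q (killingTable γ g q (n + 1)) (n + 1))

/-- The formal Killing coefficients: `killing γ g q n = (a^{2n+1}, b^{2n}, c^{2n})`. -/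
def killing (γ : ℂ) (g q : ℂ → ℂ) (n : ℕ) : Triple := killingTable γ g q n n

theorem killingTable_eq (γ : ℂ) (g q : ℂ → ℂ) {m N : ℕ} (h : m ≤ N) :
    killingTable γ g q N m = killing γ g q m := by
  induction N with
  | zero => obtain rfl : m = 0 := by omega
            rfl
  | succ N ih =>
    rcases Nat.lt_or_ge m (N + 1) with h' | h'
    · rw [← ih (by omega)]
      cases N with
      | zero => obtain rfl : m = 0 := by omega
                simp [killingTable]
      | succ N => simp only [killingTable]
                  rw [Function.update_of_ne (by omega)]
    · obtain rfl : m = N + 1 := by omega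
      rfl

theorem aHat_congr {T T' : ℕ → Triple} {N i j : ℕ} (h : ∀ m ≤ N, T m = T' m)
    (hi : i + 1 ≤ N) (hj : j + 1 ≤ N) : aHat T i j = aHat T' i j := by
  funext ζ
  simp only [aHat, h i (by omega), h (i + 1) hi, h (j + 1) hj]

/-- The formal Killing coefficients satisfy the inductive formulae. -/
theorem killing_succ (γ : ℂ) (g q : ℂ → ℂ) {n : ℕ} (hn : 1 ≤ n) :
    killing γ g q (n + 1) = nextTriple γ g q (killing γ g q) n := by
  obtain ⟨k, rfl⟩ : ∃ k, n = k + 1 := ⟨n - 1, by omega⟩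
  have h : ∀ m ≤ k + 1, killingTable γ g q (k + 1) m = killing γ g q m :=
    fun m hm => killingTable_eq γ g q hm
  have hs : sHat (killingTable γ g q (k + 1)) (k + 1) = sHat (killing γ g q) (k + 1) := by
    funext ζ
    refine Finset.sum_congr rfl fun ij hij => ?_
    simp only [Finset.mem_filter, Finset.HasAntidiagonal.mem_antidiagonal] at hij
    rw [aHat_congr h (by omega) (by omega)]
  have hm : mHat (killingTable γ g q (k + 1)) (k + 1) = mHat (killing γ g q) (k + 1) := by
    funext ζ
    unfold mHat
    split_ifs with hk
    · obtain ⟨l, hl⟩ := hk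
      rw [hs, aHat_congr h (by omega) (by omega), h _ (by omega), h _ (by omega)]
    · rw [hs, h _ (by omega)]
  change killingTable γ g q (k + 2) (k + 2) = _
  simp only [killingTable, Function.update_self, nextTriple, hm, h (k + 1) le_rfl]

/-- The higher-order conservation law `φ_n = c^{2n+2} ξ + b^{2n} ξ̄`, `n ≥ 0`: its `dζ` part. -/
def phiDz (γ : ℂ) (g q : ℂ → ℂ) (n : ℕ) (ζ : ℂ) : ℂ := (killing γ g q (n + 1)).c ζ * g ζ

/-- The `dζ̄` part of `φ_n = c^{2n+2} ξ + b^{2n} ξ̄`. -/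
def phiDzbar (γ : ℂ) (g q : ℂ → ℂ) (n : ℕ) (ζ : ℂ) : ℂ := (killing γ g q n).b ζ * conj (g ζ)

/-! ### Normal forms at an umbilic -/

/-- Generators of the ring of functions in `u` and its `z`-derivatives: `e^u`, `e^{-u}` and
`u_k`, `k ≥ 1`. -/
inductive JetVar : Type
  | expU : JetVar
  | expNegU : JetVar
  /-- `der k` stands for `u_{k+1}`. -/
  | der : ℕ → JetVar

/-- The value of the generators at the point `z`. -/
def jetValue (u : ℂ → ℝ) (z : ℂ) : JetVar → ℂ
  | .expU => (Real.exp (u z) : ℂ)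
  | .expNegU => (Real.exp (-u z) : ℂ)
  | .der k => uDer u (k + 1) z

/-- Formal polynomials in `w` with coefficients polynomial in `e^u, e^{-u}, u_1, u_2, …`. -/
abbrev WPoly : Type := Polynomial (MvPolynomial JetVar ℂ)

/-- `P` is of the form `𝒪(w^ℓ)`: a polynomial in `w` of degree `≤ ℓ` (zero if `ℓ < 0`). -/
def WPoly.IsO (P : WPoly) (l : ℤ) : Prop := ∀ k ∈ P.support, (k : ℤ) ≤ l

/-- The value of `P` at `w`, where `u` and its derivatives are evaluated at `z = w²`. -/
def WPoly.value (P : WPoly) (u : ℂ → ℝ) (w : ℂ) : ℂ :=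
  P.eval₂ (MvPolynomial.eval (jetValue u (w ^ 2))) w

/-- The frame `ξ = e^u dz = 2 w e^u dw` in the coordinate `w`, `z = w²`. -/
def umbilicFrame (u : ℂ → ℝ) (w : ℂ) : ℂ := 2 * w * (Real.exp (u (w ^ 2)) : ℂ)

/-- `h₂^{1/2} = e^{-u} w^p`, so that `h₂ = e^{-2u} z^p` and `h₂^{1/2} ξ = 2 w^{p+1} dw`. -/
def umbilicRoot (p : ℕ) (u : ℂ → ℝ) (w : ℂ) : ℂ := (Real.exp (-u (w ^ 2)) : ℂ) * w ^ p

end CMCUmbilic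

end

noncomputable section

namespace CMCUmbilic

/-! ### Wirtinger calculus -/

section Wirtinger

variable {f h : ℂ → ℂ} {z : ℂ} {V : Set ℂ}

/-! The recursion for the Killing coefficients is homogeneous. Let `h₂^{1/2}` have degree `ρ` and
let `∂_ξ` raise degrees by `δ` (here a degree, not the curvature constant). Then `m̂_n` has degree
`2n(δ-ρ)`, so `∂_ξ a^{2n+1}` and `h₂^{1/2} m̂_n` have the same degree, and induction gives the
degree and weight of every coefficient. `KillingClass` lists what a graded family of functions must
satisfy for this, and `KillingClass.killing` is the induction. It is applied to three families.

Normal forms (`killingClass_hasNormalForm`): the degree is a pair `(l, m)` standing for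
`𝒪(w^l)/w^m`. The root has degree `(0, -p)`. Since `ξ = 2w e^u dw` and `w ∂_w` maps `𝒪(w^l)` to
`𝒪(w^{l+2})`, `∂_ξ` adds `(2, 2)`. Only `z`-derivatives of `u` occur, because the connection form
enters through the conjugate of a `z̄`-derivative of the real function `u`.

Order at a zero of `ω` (`killingClass_hasOrder`): write `ω = t^m c dζ` and `ξ = t^l a dζ` with `c`,
`a` nonvanishing. The root has order `m-l` and `∂_ξ` costs `l+1`. In the `dζ` part of `φ_n` the
number `l` cancels; multiplication by `ω^{4n}` leaves `t^{(2n+1)m-2n}`, a nonnegative exponent as `m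
≥ 1`. The `dζ̄` part is better still (`exists_smooth_phi`).

Invariance (`killingClass_isEquivariant`): under a coordinate change and a rotation `ξ ↦ λξ`, `|λ| =
1`, a coefficient of weight `j` is multiplied by `λ^{-j}`. As `c` and `b` have weights `1` and `-1`,
`c ξ` and `b ξ̄` are well defined (`phi_comp`, `phi_transform`).

Finally the zeros of `ω` are isolated (`not_eventually_omega_eq_zero`), so the smooth local
extensions are unique limits; they glue and inherit the transformation rule by continuity
(`exists_smooth_differential`). -/

theorem dz_congr (hfh : f =ᶠ[𝓝 z] h) : dz f z = dz h z := by
  simp only [dz, hfh.fderiv_eq]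

theorem dzbar_congr (hfh : f =ᶠ[𝓝 z] h) : dzbar f z = dzbar h z := by
  simp only [dzbar, hfh.fderiv_eq]

theorem dz_add (hf : DifferentiableAt ℝ f z) (hh : DifferentiableAt ℝ h z) :
    dz (fun y => f y + h y) z = dz f z + dz h z := by
  simp only [dz, fderiv_fun_add hf hh, add_apply]
  ring

theorem dz_mul (hf : DifferentiableAt ℝ f z) (hh : DifferentiableAt ℝ h z) :
    dz (fun y => f y * h y) z = dz f z * h z + f z * dz h z := by
  simp only [dz, fderiv_fun_mul hf hh, add_apply,
    smul_apply, smul_eq_mul]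
  ring

theorem dzbar_mul (hf : DifferentiableAt ℝ f z) (hh : DifferentiableAt ℝ h z) :
    dzbar (fun y => f y * h y) z = dzbar f z * h z + f z * dzbar h z := by
  simp only [dzbar, fderiv_fun_mul hf hh, add_apply,
    smul_apply, smul_eq_mul]
  ring

theorem fderiv_real_apply (hf : DifferentiableAt ℂ f z) (v : ℂ) :
    fderiv ℝ f z v = deriv f z * v := by
  rw [(hf.hasFDerivAt.restrictScalars ℝ).fderiv, ContinuousLinearMap.coe_restrictScalars',
    fderiv_eq_smul_deriv, smul_eq_mul, mul_comm]

theorem dz_of_differentiableAt (hf : DifferentiableAt ℂ f z) : dz f z = deriv f z := by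
  simp only [dz, fderiv_real_apply hf]
  linear_combination (-deriv f z / 2) * Complex.I_mul_I

theorem dzbar_of_differentiableAt (hf : DifferentiableAt ℂ f z) : dzbar f z = 0 := by
  simp only [dzbar, fderiv_real_apply hf]
  linear_combination (deriv f z / 2) * Complex.I_mul_I

theorem dz_const (c : ℂ) : dz (fun _ => c) z = 0 := by
  rw [dz_of_differentiableAt (differentiableAt_const c), deriv_const]

theorem real_linear_apply (T : ℂ →L[ℝ] ℂ) (c : ℂ) : T c = c.re * T 1 + c.im * T Complex.I := by
  have h : c = c.re • (1 : ℂ) + c.im • Complex.I := by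
    rw [Complex.real_smul, Complex.real_smul, mul_one, Complex.re_add_im]
  conv_lhs => rw [h]
  rw [map_add, map_smul, map_smul, Complex.real_smul, Complex.real_smul]

/-- The differential of a holomorphic inner map is multiplication by a complex number, so no
`z̄`-derivative of `f` is mixed in. -/
theorem dz_comp {τ : ℂ → ℂ} (hf : DifferentiableAt ℝ f (τ z)) (hτ : DifferentiableAt ℂ τ z) :
    dz (fun y => f (τ y)) z = dz f (τ z) * deriv τ z := by
  have h := fderiv_fun_comp z hf (hτ.restrictScalars ℝ)
  simp only [dz, h, ContinuousLinearMap.comp_apply, fderiv_real_apply hτ]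
  rw [real_linear_apply _ (deriv τ z * 1), real_linear_apply _ (deriv τ z * Complex.I)]
  conv_rhs => rw [← Complex.re_add_im (deriv τ z)]
  simp only [mul_one, Complex.mul_re, Complex.mul_im, Complex.I_re, Complex.I_im, mul_zero,
    zero_sub, add_zero]
  push_cast
  linear_combination ((deriv τ z).im * fderiv ℝ f (τ z) Complex.I / 2) * Complex.I_mul_I

theorem dzbar_comp {τ : ℂ → ℂ} (hf : DifferentiableAt ℝ f (τ z)) (hτ : DifferentiableAt ℂ τ z) :
    dzbar (fun y => f (τ y)) z = dzbar f (τ z) * conj (deriv τ z) := by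
  have h := fderiv_fun_comp z hf (hτ.restrictScalars ℝ)
  simp only [dzbar, h, ContinuousLinearMap.comp_apply, fderiv_real_apply hτ]
  rw [real_linear_apply _ (deriv τ z * 1), real_linear_apply _ (deriv τ z * Complex.I)]
  conv_rhs => rw [← Complex.re_add_im (deriv τ z)]
  simp only [mul_one, Complex.mul_re, Complex.mul_im, Complex.I_re, Complex.I_im, mul_zero,
    zero_sub, add_zero, map_add, map_mul, Complex.conj_ofReal, Complex.conj_I]
  push_cast
  linear_combination ((deriv τ z).im * fderiv ℝ f (τ z) Complex.I / 2) * Complex.I_mul_I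

theorem dz_holomorphic_comp (hh : DifferentiableAt ℂ h (f z)) (hf : DifferentiableAt ℝ f z) :
    dz (fun y => h (f y)) z = deriv h (f z) * dz f z := by
  have H := fderiv_fun_comp z (hh.restrictScalars ℝ) hf
  simp only [dz, H, ContinuousLinearMap.comp_apply, fderiv_real_apply hh]
  ring

theorem dzbar_holomorphic_comp (hh : DifferentiableAt ℂ h (f z)) (hf : DifferentiableAt ℝ f z) :
    dzbar (fun y => h (f y)) z = deriv h (f z) * dzbar f z := by
  have H := fderiv_fun_comp z (hh.restrictScalars ℝ) hf
  simp only [dzbar, H, ContinuousLinearMap.comp_apply, fderiv_real_apply hh]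
  ring

theorem dz_conj (hf : DifferentiableAt ℝ f z) :
    dz (fun y => conj (f y)) z = conj (dzbar f z) := by
  have H : fderiv ℝ (fun y => conj (f y)) z =
      (Complex.conjCLE : ℂ →L[ℝ] ℂ).comp (fderiv ℝ f z) :=
    ((Complex.conjCLE : ℂ →L[ℝ] ℂ).hasFDerivAt.comp z hf.hasFDerivAt).fderiv
  simp only [dz, dzbar, H, ContinuousLinearMap.comp_apply, ContinuousLinearEquiv.coe_coe,
    Complex.conjCLE_apply, map_div₀, map_add, map_mul, Complex.conj_I, map_ofNat]
  ring

/-- The two Wirtinger derivatives of a real valued function are conjugate. -/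
theorem conj_dzbar_ofReal {v : ℂ → ℝ} (hv : DifferentiableAt ℝ (fun y => (v y : ℂ)) z) :
    conj (dzbar (fun y => (v y : ℂ)) z) = dz (fun y => (v y : ℂ)) z := by
  rw [← dz_conj hv]
  simp only [Complex.conj_ofReal]

theorem contDiffOn_fderiv_apply (hV : IsOpen V) (hf : ContDiffOn ℝ ∞ f V) (v : ℂ) :
    ContDiffOn ℝ ∞ (fun y => fderiv ℝ f y v) V :=
  (hf.fderiv_of_isOpen hV (by simp)).clm_apply contDiffOn_const

theorem contDiffOn_dz (hV : IsOpen V) (hf : ContDiffOn ℝ ∞ f V) : ContDiffOn ℝ ∞ (dz f) V :=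
  ((contDiffOn_fderiv_apply hV hf 1).sub
    (contDiffOn_const.mul (contDiffOn_fderiv_apply hV hf Complex.I))).div_const 2

theorem contDiffOn_dzbar (hV : IsOpen V) (hf : ContDiffOn ℝ ∞ f V) :
    ContDiffOn ℝ ∞ (dzbar f) V :=
  ((contDiffOn_fderiv_apply hV hf 1).add
    (contDiffOn_const.mul (contDiffOn_fderiv_apply hV hf Complex.I))).div_const 2

theorem contDiffOn_conj (hf : ContDiffOn ℝ ∞ f V) : ContDiffOn ℝ ∞ (fun y => conj (f y)) V :=
  (Complex.conjCLE : ℂ →L[ℝ] ℂ).contDiff.comp_contDiffOn hf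

theorem contDiffOn_div (hf : ContDiffOn ℝ ∞ f V) (hh : ContDiffOn ℝ ∞ h V)
    (h0 : ∀ y ∈ V, h y ≠ 0) : ContDiffOn ℝ ∞ (fun y => f y / h y) V := by
  simpa only [div_eq_mul_inv] using hf.mul (ContDiffOn.fun_inv hh h0)

theorem contDiffOn_real_of_holomorphic (hV : IsOpen V) (hf : DifferentiableOn ℂ f V) :
    ContDiffOn ℝ ∞ f V :=
  (hf.contDiffOn hV).restrict_scalars ℝ

theorem differentiableAt_of_contDiffOn {E F : Type*} [NormedAddCommGroup E] [NormedSpace ℝ E]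
    [NormedAddCommGroup F] [NormedSpace ℝ F] {f : E → F} {V : Set E} {z : E} (hV : IsOpen V)
    (hf : ContDiffOn ℝ ∞ f V) (hz : z ∈ V) : DifferentiableAt ℝ f z :=
  (hf.differentiableOn (by simp)).differentiableAt (hV.mem_nhds hz)

end Wirtinger

/-! ### The degrees of the formal Killing coefficients -/

/-- A family `M` of sets of functions, graded by the weight in `ℤ` and by a degree in `A`, which is
closed under the operations in the inductive formulae for the formal Killing coefficients: `h₂^{1/2}`
has degree `ρ` and `∂_ξ` has degree `δ`. The functions may depend on a parameter in `I`. -/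
structure KillingClass {I A : Type*} [AddCommGroup A] (g q : I → ℂ → ℂ) (ρ δ : A)
    (M : ℤ → A → (I → ℂ → ℂ) → Prop) : Prop where
  zero : ∀ j α, M j α (fun _ _ => 0)
  add : ∀ {j α f h}, M j α f → M j α h → M j α (fun i ζ => f i ζ + h i ζ)
  const_mul : ∀ {j α f} (c : ℂ), M j α f → M j α (fun i ζ => c * f i ζ)
  mul : ∀ {j α f k β h}, M j α f → M k β h → M (j + k) (α + β) (fun i ζ => f i ζ * h i ζ)
  deriv : ∀ {j α f}, M j α f → M (j + 1) (α + δ) (fun i => dXi (g i) j (f i))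
  root : M 1 ρ q
  root_inv : M (-1) (-ρ) (fun i ζ => (q i ζ)⁻¹)

namespace KillingClass

variable {I A : Type*} [AddCommGroup A] {g q : I → ℂ → ℂ} {ρ δ : A}
  {M : ℤ → A → (I → ℂ → ℂ) → Prop}

-- Weights and degrees produced by the closure rules agree with the wanted ones only up to ring
-- identities; this transports membership along them.
omit [AddCommGroup A] in
theorem cast {j j' : ℤ} {α α' : A} {f f' : I → ℂ → ℂ} (h : M j α f) (hj : j = j') (hα : α = α')
    (hf : ∀ i ζ, f i ζ = f' i ζ) : M j' α' f' := by
  obtain rfl : f = f' := funext fun i => funext (hf i)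
  exact hj ▸ hα ▸ h

theorem sub (K : KillingClass g q ρ δ M) {j : ℤ} {α : A} {f h : I → ℂ → ℂ} (hf : M j α f)
    (hh : M j α h) : M j α (fun i ζ => f i ζ - h i ζ) :=
  cast (K.add hf (K.const_mul (-1) hh)) rfl rfl fun i ζ => by ring

theorem sum (K : KillingClass g q ρ δ M) {j : ℤ} {α : A} {ι : Type*} (s : Finset ι)
    {f : ι → I → ℂ → ℂ} (hf : ∀ k ∈ s, M j α (f k)) :
    M j α (fun i ζ => ∑ k ∈ s, f k i ζ) := by
  classical
  induction s using Finset.induction_on with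
  | empty => simpa using K.zero j α
  | insert k s hk ih =>
    refine cast (K.add (hf k (Finset.mem_insert_self k s))
      (ih fun l hl => hf l (Finset.mem_insert_of_mem hl))) rfl rfl fun i ζ => ?_
    rw [Finset.sum_insert hk]

/-- The degrees of the triple `(a^{2m+1}, b^{2m}, c^{2m})`. -/
def HasDegrees (ρ δ : A) (M : ℤ → A → (I → ℂ → ℂ) → Prop) (m : ℕ) (T : I → Triple) : Prop :=
  M 0 ((2 * m - 1 : ℤ) • (δ - ρ)) (fun i => (T i).a) ∧
  M (-1) ((2 * m - 2 : ℤ) • δ - (2 * m - 1 : ℤ) • ρ) (fun i => (T i).b) ∧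
  M 1 ((2 * m - 2 : ℤ) • δ - (2 * m - 3 : ℤ) • ρ) (fun i => (T i).c)

/-- The degrees of `b` and `c` are offset from each other by `2ρ` so that `b^{2i+2} c^{2j+2}` has
the same degree as `a^{2i+1} a^{2j+3}`, depending only on `i + j`; the weights `-1` and `1` cancel.
-/
theorem aHat (K : KillingClass g q ρ δ M) {T : I → ℕ → Triple} {i j n : ℕ} (hij : i + j = n)
    (h0 : HasDegrees ρ δ M i (fun x => T x i))
    (h1 : HasDegrees ρ δ M (i + 1) (fun x => T x (i + 1)))
    (h2 : HasDegrees ρ δ M (j + 1) (fun x => T x (j + 1))) :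
    M 0 ((2 * n : ℤ) • (δ - ρ)) (fun x => aHat (T x) i j) := by
  subst hij
  refine cast (K.sub (K.sub (cast (K.mul h0.1 h2.1) (by ring) ?_ fun _ _ => rfl)
    (cast (K.const_mul 2 (K.mul h1.2.1 h2.2.2)) (by ring) ?_ fun _ _ => rfl))
    (cast (K.const_mul 2 (K.mul h2.2.1 h1.2.2)) (by ring) ?_ fun _ _ => rfl)) rfl rfl
    fun x ζ => ?_
  · push_cast; module
  · push_cast; module
  · push_cast; module
  · simp only [CMCUmbilic.aHat]; ring

/-- The restriction `1 ≤ i ≤ j` keeps all triple indices `i`, `i+1`, `j+1` between `1` and `n`.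
Hence the zero triple, which has no place in the degree pattern, never enters and the induction
hypothesis suffices. -/
theorem mHat (K : KillingClass g q ρ δ M) {T : I → ℕ → Triple} {n : ℕ} (hn : 1 ≤ n)
    (hT : ∀ m, 1 ≤ m → m ≤ n → HasDegrees ρ δ M m (fun x => T x m)) :
    M 0 ((2 * n : ℤ) • (δ - ρ)) (fun x => mHat (T x) n) := by
  have hs : M 0 ((2 * n : ℤ) • (δ - ρ)) (fun x => sHat (T x) n) := by
    refine K.sum _ fun ij hij => ?_
    simp only [Finset.mem_filter, Finset.HasAntidiagonal.mem_antidiagonal] at hij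
    exact K.aHat hij.1 (hT _ (by omega) (by omega)) (hT _ (by omega) (by omega))
      (hT _ (by omega) (by omega))
  rcases Nat.even_or_odd n with he | ho
  · obtain ⟨l, rfl⟩ := he
    have h1 := hT l (by omega) (by omega)
    have h2 := hT (l + 1) (by omega) (by omega)
    refine cast (K.add hs (K.const_mul (1 / 2) (K.add (K.const_mul (-1) (K.aHat rfl h1 h2 h2))
      (cast (K.mul h1.1 h2.1) (by ring) ?_ fun _ _ => rfl)))) rfl rfl fun x ζ => ?_
    · push_cast; module
    · have hl : (l + l) / 2 = l := by omega
      simp only [CMCUmbilic.mHat, if_pos (Even.add_self l), hl]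
      ring
  · have hne : ¬ Even n := Nat.not_even_iff_odd.mpr ho
    obtain ⟨l, rfl⟩ := ho
    have h2 := hT (l + 1) (by omega) (by omega)
    refine cast (K.add hs (K.const_mul (1 / 2)
      (cast (K.mul h2.1 h2.1) (by ring) ?_ fun _ _ => rfl))) rfl rfl fun x ζ => ?_
    · push_cast; module
    · have hl : (2 * l + 1 + 1) / 2 = l + 1 := by omega
      simp only [CMCUmbilic.mHat, if_neg hne, hl]
      ring

theorem firstTriple (K : KillingClass g q ρ δ M) (γ : ℂ) :
    HasDegrees ρ δ M 1 (fun x => firstTriple γ (g x) (q x)) := by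
  refine ⟨?_, ?_, ?_⟩
  · refine cast (K.mul (K.deriv (j := 2) (K.mul K.root K.root))
      (K.mul K.root_inv (K.mul K.root_inv K.root_inv))) (by ring) ?_ fun x ζ => ?_
    · push_cast; module
    · simp only [CMCUmbilic.firstTriple, pow_two, div_eq_mul_inv]
      ring
  · refine cast (K.const_mul (-Complex.I * γ) K.root_inv) rfl ?_ fun x ζ => ?_
    · push_cast; module
    · simp only [CMCUmbilic.firstTriple, div_eq_mul_inv]
  · refine cast (K.const_mul Complex.I K.root) rfl ?_ fun x ζ => rfl
    push_cast; module

theorem nextTriple (K : KillingClass g q ρ δ M) (γ : ℂ) {T : I → ℕ → Triple} {n : ℕ} (hn : 1 ≤ n)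
    (hT : ∀ m, 1 ≤ m → m ≤ n → HasDegrees ρ δ M m (fun x => T x m)) :
    HasDegrees ρ δ M (n + 1) (fun x => nextTriple γ (g x) (q x) (T x) n) := by
  have hm := K.mul K.root (K.mHat hn hT)
  have ha := K.deriv (hT n hn le_rfl).1
  -- Homogeneity of the recursion: `ρ + 2n(δ-ρ) = (2n-1)(δ-ρ) + δ`, the degree of `∂_ξ a^{2n+1}`.
  have hm' : M (0 + 1) ((2 * n - 1 : ℤ) • (δ - ρ) + δ) (fun x ζ => q x ζ * CMCUmbilic.mHat (T x) n ζ) :=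
    cast hm (by ring) (by module) fun _ _ => rfl
  have hc : M 1 ((2 * n : ℤ) • δ - (2 * n - 1 : ℤ) • ρ)
      (fun x => (CMCUmbilic.nextTriple γ (g x) (q x) (T x) n).c) := by
    refine cast (K.const_mul (Complex.I / (2 * γ)) (K.add (K.const_mul (-1) ha)
      (K.const_mul (1 / 2) hm'))) (by ring) (by module) fun x ζ => ?_
    simp only [CMCUmbilic.nextTriple]
    ring
  refine ⟨?_, ?_, ?_⟩
  · refine cast (K.mul (K.const_mul (-2 * Complex.I) (K.mul K.root_inv K.root_inv))
      (K.deriv hc)) (by ring) ?_ fun x ζ => ?_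
    · push_cast; module
    · simp only [CMCUmbilic.nextTriple, div_eq_mul_inv]
      ring
  · refine cast (K.mul (K.const_mul (Complex.I / 2) (K.mul K.root_inv K.root_inv))
      (K.sub (K.const_mul (-1) ha) (K.const_mul (1 / 2) hm'))) (by ring) ?_ fun x ζ => ?_
    · push_cast; module
    · simp only [CMCUmbilic.nextTriple, div_eq_mul_inv, mul_inv]
      ring
  · refine cast hc rfl ?_ fun _ _ => rfl
    push_cast; module

/-- The degrees of the formal Killing coefficients. -/
theorem killing (K : KillingClass g q ρ δ M) (γ : ℂ) :
    ∀ m, 1 ≤ m → HasDegrees ρ δ M m (fun x => killing γ (g x) (q x) m) := by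
  intro m
  induction m using Nat.strong_induction_on with
  | _ m ih =>
    intro hm
    obtain ⟨n, rfl⟩ : ∃ n, m = n + 1 := ⟨m - 1, by omega⟩
    rcases Nat.eq_zero_or_pos n with rfl | hn
    · refine (K.firstTriple γ : HasDegrees ρ δ M 1 _)
    · simp only [killing_succ γ _ _ hn]
      exact K.nextTriple γ hn fun m h1 h2 => ih m (by omega) h1

end KillingClass

/-! ### Normal forms at an umbilic -/

section Jets

variable {u : ℂ → ℝ} {U : Set ℂ}

theorem contDiffOn_ofReal {v : ℂ → ℝ} (hv : ContDiffOn ℝ ∞ v U) :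
    ContDiffOn ℝ ∞ (fun z => (v z : ℂ)) U :=
  Complex.ofRealCLM.contDiff.comp_contDiffOn hv

theorem uDer_succ (u : ℂ → ℝ) (k : ℕ) : uDer u (k + 1) = dz (uDer u k) :=
  Function.iterate_succ_apply' _ _ _

theorem contDiffOn_uDer (hU : IsOpen U) (hu : ContDiffOn ℝ ∞ u U) (k : ℕ) :
    ContDiffOn ℝ ∞ (uDer u k) U := by
  induction k with
  | zero => exact contDiffOn_ofReal hu
  | succ k ih => exact uDer_succ u k ▸ contDiffOn_dz hU ih

theorem contDiffOn_jetValue (hU : IsOpen U) (hu : ContDiffOn ℝ ∞ u U) (v : JetVar) :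
    ContDiffOn ℝ ∞ (fun z => jetValue u z v) U := by
  cases v with
  | expU => exact contDiffOn_ofReal hu.exp
  | expNegU => exact contDiffOn_ofReal hu.neg.exp
  | der k => exact contDiffOn_uDer hU hu (k + 1)

theorem contDiffOn_eval_jetValue (hU : IsOpen U) (hu : ContDiffOn ℝ ∞ u U)
    (a : MvPolynomial JetVar ℂ) :
    ContDiffOn ℝ ∞ (fun z => MvPolynomial.eval (jetValue u z) a) U := by
  induction a using MvPolynomial.induction_on with
  | C c => simpa only [MvPolynomial.eval_C] using contDiffOn_const
  | add a b ha hb => simpa only [map_add] using ha.add hb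
  | mul_X a v ha =>
    simpa only [map_mul, MvPolynomial.eval_X] using ha.mul (contDiffOn_jetValue hU hu v)

theorem dz_exp {v : ℂ → ℝ} {z : ℂ} (hv : DifferentiableAt ℝ (fun y => (v y : ℂ)) z) :
    dz (fun y => (Real.exp (v y) : ℂ)) z = (Real.exp (v z) : ℂ) * dz (fun y => (v y : ℂ)) z := by
  simp only [Complex.ofReal_exp]
  rw [dz_holomorphic_comp (h := Complex.exp) Complex.differentiableAt_exp hv,
    Complex.deriv_exp]

theorem dzbar_exp {v : ℂ → ℝ} {z : ℂ} (hv : DifferentiableAt ℝ (fun y => (v y : ℂ)) z) :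
    dzbar (fun y => (Real.exp (v y) : ℂ)) z =
      (Real.exp (v z) : ℂ) * dzbar (fun y => (v y : ℂ)) z := by
  simp only [Complex.ofReal_exp]
  rw [dzbar_holomorphic_comp (h := Complex.exp) Complex.differentiableAt_exp hv,
    Complex.deriv_exp]

/-- For the unit form `ξ = e^v H dζ` with `H` holomorphic, `i ρ` has `(1,0)`-part `-v_ζ dζ`. -/
theorem conj_dzbar_frame_div {v : ℂ → ℝ} {H : ℂ → ℂ} {z : ℂ}
    (hv : DifferentiableAt ℝ v z) (hH : DifferentiableAt ℂ H z)
    (h0 : H z ≠ 0) :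
    conj (dzbar (fun y => H y * (Real.exp (v y) : ℂ)) z / (H z * (Real.exp (v z) : ℂ))) =
      dz (fun y => (v y : ℂ)) z := by
  have hv' : DifferentiableAt ℝ (fun y => (v y : ℂ)) z :=
    Complex.ofRealCLM.differentiableAt.comp z hv
  have he : DifferentiableAt ℝ (fun y => (Real.exp (v y) : ℂ)) z :=
    Complex.ofRealCLM.differentiableAt.comp z hv.exp
  have hne : (Real.exp (v z) : ℂ) ≠ 0 := Complex.ofReal_ne_zero.mpr (Real.exp_ne_zero _)
  rw [dzbar_mul (hH.restrictScalars ℝ) he, dzbar_of_differentiableAt hH, dzbar_exp hv',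
    ← conj_dzbar_ofReal hv']
  congr 1
  field_simp
  ring

/-- The ring of polynomials in the jets of `u` is closed under `∂/∂z`. -/
theorem exists_dz_eval_jetValue (a : MvPolynomial JetVar ℂ) :
    ∃ a' : MvPolynomial JetVar ℂ, ∀ (u : ℂ → ℝ) (U : Set ℂ), IsOpen U → ContDiffOn ℝ ∞ u U →
      ∀ z ∈ U, dz (fun y => MvPolynomial.eval (jetValue u y) a) z =
        MvPolynomial.eval (jetValue u z) a' := by
  induction a using MvPolynomial.induction_on with
  | C c => exact ⟨0, fun u U hU hu z hz => by simp [dz_const]⟩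
  | add a b ha hb =>
    obtain ⟨a', ha⟩ := ha
    obtain ⟨b', hb⟩ := hb
    refine ⟨a' + b', fun u U hU hu z hz => ?_⟩
    simp only [map_add]
    rw [dz_add (differentiableAt_of_contDiffOn hU (contDiffOn_eval_jetValue hU hu a) hz)
      (differentiableAt_of_contDiffOn hU (contDiffOn_eval_jetValue hU hu b) hz), ha u U hU hu z hz,
      hb u U hU hu z hz]
  | mul_X a v ha =>
    obtain ⟨a', ha⟩ := ha
    -- By the Leibniz rule only the generators matter: `e^u ↦ e^u u₁`, `e^{-u} ↦ -e^{-u} u₁`, `u_k ↦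
    -- u_{k+1}`.
    obtain ⟨b, hb⟩ : ∃ b : MvPolynomial JetVar ℂ, ∀ (u : ℂ → ℝ) (U : Set ℂ), IsOpen U →
        ContDiffOn ℝ ∞ u U → ∀ z ∈ U, dz (fun y => jetValue u y v) z =
          MvPolynomial.eval (jetValue u z) b := by
      cases v with
      | expU =>
        refine ⟨MvPolynomial.X .expU * MvPolynomial.X (.der 0), fun u U hU hu z hz => ?_⟩
        simp only [jetValue, map_mul, MvPolynomial.eval_X]
        exact dz_exp (differentiableAt_of_contDiffOn hU (contDiffOn_ofReal hu) hz)
      | expNegU =>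
        refine ⟨MvPolynomial.C (-1) * (MvPolynomial.X .expNegU * MvPolynomial.X (.der 0)),
          fun u U hU hu z hz => ?_⟩
        have hd := differentiableAt_of_contDiffOn hU (contDiffOn_ofReal hu) hz
        have hn : dz (fun y => ((-u y : ℝ) : ℂ)) z = -1 * dz (fun y => (u y : ℂ)) z := by
          have := dz_mul (f := fun _ => -1) (differentiableAt_const _) hd
          rw [dz_const] at this
          simpa using this
        simp only [jetValue, map_mul, MvPolynomial.eval_X, MvPolynomial.eval_C]
        rw [dz_exp (differentiableAt_of_contDiffOn hU (contDiffOn_ofReal hu.neg) hz), hn,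
          show uDer u (0 + 1) z = dz (fun y => (u y : ℂ)) z from rfl]
        ring
      | der k =>
        refine ⟨MvPolynomial.X (.der (k + 1)), fun u U hU hu z hz => ?_⟩
        simp only [jetValue, MvPolynomial.eval_X]
        rw [uDer_succ u (k + 1)]
    refine ⟨a' * MvPolynomial.X v + a * b, fun u U hU hu z hz => ?_⟩
    simp only [map_add, map_mul, MvPolynomial.eval_X]
    rw [dz_mul (differentiableAt_of_contDiffOn hU (contDiffOn_eval_jetValue hU hu a) hz)
      (differentiableAt_of_contDiffOn hU (contDiffOn_jetValue hU hu v) hz), ha u U hU hu z hz,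
      hb u U hU hu z hz]

end Jets

namespace WPoly

variable {P Q : WPoly} {l k : ℤ}

theorem IsO.mono (h : P.IsO l) (hlk : l ≤ k) : P.IsO k := fun i hi => (h i hi).trans hlk

theorem isO_zero (l : ℤ) : IsO 0 l := fun i hi => by simp at hi

theorem IsO.add (hP : P.IsO l) (hQ : Q.IsO l) : (P + Q).IsO l := fun i hi => by
  rcases Finset.mem_union.mp (Polynomial.support_add hi) with h | h
  exacts [hP i h, hQ i h]

theorem isO_monomial (n : ℕ) (a : MvPolynomial JetVar ℂ) : IsO (Polynomial.monomial n a) n :=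
  fun i hi => by
    have := Finset.mem_singleton.mp (Polynomial.support_monomial_subset n a hi)
    omega

theorem isO_C (a : MvPolynomial JetVar ℂ) : IsO (Polynomial.C a) 0 := isO_monomial 0 a

theorem IsO.mul (hP : P.IsO l) (hQ : Q.IsO k) : (P * Q).IsO (l + k) := fun i hi => by
  rw [Polynomial.mem_support_iff, Polynomial.coeff_mul] at hi
  obtain ⟨x, hx, h⟩ := Finset.exists_ne_zero_of_sum_ne_zero hi
  rw [Finset.HasAntidiagonal.mem_antidiagonal] at hx
  have := hP x.1 (Polynomial.mem_support_iff.mpr (left_ne_zero_of_mul h))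
  have := hQ x.2 (Polynomial.mem_support_iff.mpr (right_ne_zero_of_mul h))
  omega

variable (P Q) (u : ℂ → ℝ) (w : ℂ)

theorem value_add : (P + Q).value u w = P.value u w + Q.value u w := Polynomial.eval₂_add _ _

theorem value_mul : (P * Q).value u w = P.value u w * Q.value u w := Polynomial.eval₂_mul _ _

theorem value_zero : (0 : WPoly).value u w = 0 := Polynomial.eval₂_zero _ _

theorem value_monomial (n : ℕ) (a : MvPolynomial JetVar ℂ) :
    WPoly.value (Polynomial.monomial n a) u w = MvPolynomial.eval (jetValue u (w ^ 2)) a * w ^ n :=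
  Polynomial.eval₂_monomial _ _

theorem value_C (a : MvPolynomial JetVar ℂ) :
    WPoly.value (Polynomial.C a) u w = MvPolynomial.eval (jetValue u (w ^ 2)) a :=
  Polynomial.eval₂_C _ _

variable {P Q u w}

theorem differentiableAt_eval_sq {U : Set ℂ} (hU : IsOpen U) (hu : ContDiffOn ℝ ∞ u U)
    (hw : w ^ 2 ∈ U) (a : MvPolynomial JetVar ℂ) :
    DifferentiableAt ℝ (fun y => MvPolynomial.eval (jetValue u (y ^ 2)) a) w := by
  have h1 := differentiableAt_of_contDiffOn hU (contDiffOn_eval_jetValue hU hu a) hw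
  exact DifferentiableAt.comp (g := fun z => MvPolynomial.eval (jetValue u z) a)
    (f := fun y : ℂ => y ^ 2) w h1 (differentiableAt_fun_id.pow 2)

/-- `w ∂/∂w` maps `𝒪(w^l)` to `𝒪(w^(l+2))`. -/
theorem exists_dz_value (hP : P.IsO l) : ∃ P' : WPoly, P'.IsO (l + 2) ∧
    ∀ (u : ℂ → ℝ) (U : Set ℂ), IsOpen U → ContDiffOn ℝ ∞ u U → ∀ w, w ^ 2 ∈ U →
      DifferentiableAt ℝ (P.value u) w ∧ w * dz (P.value u) w = P'.value u w := by
  let p : WPoly → Prop := fun P => ∃ P' : WPoly, P'.IsO (l + 2) ∧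
    ∀ (u : ℂ → ℝ) (U : Set ℂ), IsOpen U → ContDiffOn ℝ ∞ u U → ∀ w, w ^ 2 ∈ U →
      DifferentiableAt ℝ (P.value u) w ∧ w * dz (P.value u) w = P'.value u w
  suffices h : p (∑ n ∈ P.support, Polynomial.monomial n (P.coeff n)) by
    rwa [← P.as_sum_support] at h
  refine Finset.sum_induction _ p ?_ ?_ ?_
  · rintro P Q ⟨P', hP', h⟩ ⟨Q', hQ', h'⟩
    refine ⟨P' + Q', hP'.add hQ', fun u U hU hu w hw => ?_⟩
    obtain ⟨d, e⟩ := h u U hU hu w hw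
    obtain ⟨d', e'⟩ := h' u U hU hu w hw
    have hs : (P + Q).value u = fun w => P.value u w + Q.value u w :=
      funext fun w => value_add P Q u w
    rw [hs, dz_add d d', value_add, ← e, ← e']
    exact ⟨d.add d', by ring⟩
  · refine ⟨0, isO_zero _, fun u U hU hu w hw => ?_⟩
    have hs : (0 : WPoly).value u = fun _ => 0 := funext fun w => value_zero u w
    rw [hs, dz_const]
    exact ⟨differentiableAt_const _, by simp⟩
  · intro n hn
    have hnl := hP n hn
    obtain ⟨a', ha⟩ := exists_dz_eval_jetValue (P.coeff n)
    -- For `A(z) w^n` with `z = w²`, `w ∂_w` gives `n A w^n + 2 A_z w^{n+2}`: differentiating a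
    -- coefficient yields `2w`, and the outer `w` supplies the second power.
    refine ⟨Polynomial.monomial n (MvPolynomial.C (n : ℂ) * P.coeff n) +
      Polynomial.monomial (n + 2) (MvPolynomial.C 2 * a'),
      ((isO_monomial _ _).mono (by omega)).add ((isO_monomial _ _).mono (by push_cast; omega)),
      fun u U hU hu w hw => ?_⟩
    have hd := differentiableAt_eval_sq hU hu hw (P.coeff n)
    have hp : DifferentiableAt ℝ (fun y : ℂ => y ^ n) w := differentiableAt_fun_id.pow n
    have hs : WPoly.value (Polynomial.monomial n (P.coeff n)) u =
        fun w => MvPolynomial.eval (jetValue u (w ^ 2)) (P.coeff n) * w ^ n :=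
      funext fun w => value_monomial u w _ _
    have h2 : dz (fun y => MvPolynomial.eval (jetValue u (y ^ 2)) (P.coeff n)) w =
        MvPolynomial.eval (jetValue u (w ^ 2)) a' * (2 * w) := by
      rw [dz_comp (f := fun z => MvPolynomial.eval (jetValue u z) (P.coeff n)) (τ := fun y => y ^ 2)
        (differentiableAt_of_contDiffOn hU (contDiffOn_eval_jetValue hU hu _) hw)
        (differentiableAt_fun_id.pow 2), ha u U hU hu _ hw]
      simp
    have h3 : w * dz (fun y : ℂ => y ^ n) w = n * w ^ n := by
      rw [dz_of_differentiableAt (differentiableAt_pow n)]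
      cases n with
      | zero => simp
      | succ n => simp; ring
    refine ⟨hs ▸ hd.mul hp, ?_⟩
    rw [hs, dz_mul hd hp, h2, value_add, value_monomial, value_monomial, mul_add,
      mul_left_comm w (MvPolynomial.eval (jetValue u (w ^ 2)) (P.coeff n)), h3]
    simp only [map_mul, MvPolynomial.eval_C]
    ring

end WPoly

/-- Smooth functions on open sets of `ℂ`. -/
abbrev LocalPotential : Type :=
  {x : (ℂ → ℝ) × Set ℂ // IsOpen x.2 ∧ ContDiffOn ℝ ∞ x.1 x.2}

/-- Functions of the form `𝒪(w^l) / w^m`, with `α = (l, m)`. -/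
def HasNormalForm (_ : ℤ) (α : ℤ × ℤ) (f : LocalPotential → ℂ → ℂ) : Prop :=
  ∃ P : WPoly, P.IsO α.1 ∧ ∀ (x : LocalPotential) (w : ℂ), w ≠ 0 → w ^ 2 ∈ x.1.2 →
    f x w = w ^ (-α.2) * P.value x.1.1 w

theorem eventually_ne_zero_and_sq_mem {U : Set ℂ} (hU : IsOpen U) {w : ℂ} (hw : w ≠ 0)
    (hwU : w ^ 2 ∈ U) : ∀ᶠ y in 𝓝 w, y ≠ 0 ∧ y ^ 2 ∈ U :=
  (isOpen_ne.eventually_mem hw).and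
    ((continuous_pow 2).continuousAt.eventually_mem (hU.mem_nhds hwU))

/-- With `α = (l, m)`, multiplying numerator and denominator by `w` turns `∂_w` into `w ∂_w` and the
frame `2w e^u` into `2w² e^u`. The denominator thus gains `w²`, while both `w ∂_w` and the
connection term raise the numerator by at most two degrees. -/
theorem HasNormalForm.dXi {j : ℤ} {α : ℤ × ℤ} {f : LocalPotential → ℂ → ℂ}
    (hf : HasNormalForm j α f) :
    HasNormalForm (j + 1) (α + (2, 2)) (fun x => dXi (umbilicFrame x.1.1) j (f x)) := by
  obtain ⟨P, hP, h⟩ := hf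
  obtain ⟨P', hP', h'⟩ := WPoly.exists_dz_value hP
  -- The new numerator is `½ e^{-u} (-m P + w P_w - 2j w² u₁ P)`, where `α = (l, m)`: the summands
  -- come from `w^{-m}`, from `P`, and from the connection form.
  refine ⟨Polynomial.C (MvPolynomial.C (1 / 2) * MvPolynomial.X .expNegU) *
    ((Polynomial.C (MvPolynomial.C (-(α.2 : ℂ))) * P + P') +
      Polynomial.monomial 2 (MvPolynomial.C (-2 * (j : ℂ)) * MvPolynomial.X (.der 0)) * P),
    ?_, ?_⟩
  · have h1 := (WPoly.isO_C (MvPolynomial.C (-(α.2 : ℂ)))).mul hP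
    have h2 := (WPoly.isO_monomial 2 (MvPolynomial.C (-2 * (j : ℂ)) *
      MvPolynomial.X (.der 0))).mul hP
    exact ((WPoly.isO_C _).mul (((h1.mono (by omega)).add hP').add
      (h2.mono (by push_cast; omega)))).mono (by simp)
  · rintro ⟨⟨u, U⟩, hU, hu⟩ w hw hwU
    simp only at hU hu hwU h ⊢
    obtain ⟨d, e⟩ := h' u U hU hu w hwU
    have hz : DifferentiableAt ℂ (fun y : ℂ => y ^ (-α.2)) w :=
      differentiableAt_zpow.mpr (Or.inl hw)
    have hdf : w * dz (f ⟨(u, U), hU, hu⟩) w =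
        w ^ (-α.2) * (-α.2 * P.value u w + P'.value u w) := by
      have hev : f ⟨(u, U), hU, hu⟩ =ᶠ[𝓝 w] fun y => y ^ (-α.2) * P.value u y := by
        filter_upwards [eventually_ne_zero_and_sq_mem hU hw hwU] with y hy
        exact h ⟨(u, U), hU, hu⟩ y hy.1 hy.2
      rw [dz_congr hev, dz_mul (hz.restrictScalars ℝ) d, dz_of_differentiableAt hz, deriv_zpow,
        mul_add, mul_left_comm w (w ^ (-α.2)), e, zpow_sub_one₀ hw]
      push_cast
      field_simp
    have hsq : DifferentiableAt ℂ (fun y : ℂ => y ^ 2) w := differentiableAt_fun_id.pow 2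
    have hv : DifferentiableAt ℝ (fun y => u (y ^ 2)) w :=
      DifferentiableAt.comp (g := u) (f := fun y : ℂ => y ^ 2) w
        (differentiableAt_of_contDiffOn hU hu hwU) (hsq.restrictScalars ℝ)
    have hρ : conj (dzbar (umbilicFrame u) w / umbilicFrame u w) =
        2 * w * uDer u (0 + 1) (w ^ 2) := by
      have := conj_dzbar_frame_div (v := fun y => u (y ^ 2)) (H := fun y => 2 * y) hv
        (differentiableAt_fun_id.const_mul 2) (mul_ne_zero two_ne_zero hw)
      refine this.trans ?_
      rw [dz_comp (f := fun z => (u z : ℂ)) (τ := fun y => y ^ 2)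
        (differentiableAt_of_contDiffOn hU (contDiffOn_ofReal hu) hwU) hsq]
      simp [uDer, mul_comm]
    have hE : (Real.exp (u (w ^ 2)) : ℂ) ≠ 0 := Complex.ofReal_ne_zero.mpr (Real.exp_ne_zero _)
    have hdf' : dz (f ⟨(u, U), hU, hu⟩) w =
        w ^ (-α.2) * (-α.2 * P.value u w + P'.value u w) / w := by
      rw [← hdf]; field_simp
    have hpow : w ^ (-(α + (2, 2)).2) = w ^ (-α.2) / w ^ 2 := by
      rw [Prod.snd_add, neg_add, ← sub_eq_add_neg, zpow_sub₀ hw]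
      rfl
    rw [CMCUmbilic.dXi, hρ, hdf', hpow, h ⟨(u, U), hU, hu⟩ w hw hwU]
    simp only [umbilicFrame,
      WPoly.value_mul, WPoly.value_add, WPoly.value_C, WPoly.value_monomial, map_mul,
      MvPolynomial.eval_C, MvPolynomial.eval_X, jetValue, Real.exp_neg]
    push_cast at hE ⊢
    field_simp
    ring

/-- The parameter runs over all smooth `u` on all open sets, so each membership supplies a single
polynomial valid for every surface and every adapted coordinate. -/
theorem killingClass_hasNormalForm (p : ℕ) :
    KillingClass (fun x : LocalPotential => umbilicFrame x.1.1)
      (fun x => umbilicRoot p x.1.1) (0, -(p : ℤ)) (2, 2) HasNormalForm where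
  zero j α := ⟨0, WPoly.isO_zero _, fun x w _ _ => by rw [WPoly.value_zero, mul_zero]⟩
  add := by
    rintro j α f h ⟨P, hP, e⟩ ⟨Q, hQ, e'⟩
    refine ⟨P + Q, hP.add hQ, fun x w hw hx => ?_⟩
    simp only [WPoly.value_add, e x w hw hx, e' x w hw hx, mul_add]
  const_mul := by
    rintro j α f c ⟨P, hP, e⟩
    refine ⟨Polynomial.C (MvPolynomial.C c) * P, ((WPoly.isO_C _).mul hP).mono (by simp),
      fun x w hw hx => ?_⟩
    simp only [WPoly.value_mul, WPoly.value_C, MvPolynomial.eval_C, e x w hw hx]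
    ring
  mul := by
    rintro j α f k β h ⟨P, hP, e⟩ ⟨Q, hQ, e'⟩
    refine ⟨P * Q, hP.mul hQ, fun x w hw hx => ?_⟩
    simp only [WPoly.value_mul, e x w hw hx, e' x w hw hx, Prod.snd_add, neg_add, zpow_add₀ hw]
    ring
  deriv := HasNormalForm.dXi
  root := by
    refine ⟨Polynomial.C (MvPolynomial.X .expNegU), WPoly.isO_C _, fun x w hw hx => ?_⟩
    rw [WPoly.value_C, MvPolynomial.eval_X, neg_neg, zpow_natCast]
    exact mul_comm _ _
  root_inv := by
    refine ⟨Polynomial.C (MvPolynomial.X .expU), (WPoly.isO_C _).mono (by simp),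
      fun x w hw hx => ?_⟩
    simp only [WPoly.value_C, MvPolynomial.eval_X, Prod.snd_neg, neg_neg, zpow_neg, zpow_natCast,
      umbilicRoot, jetValue, Real.exp_neg]
    push_cast
    rw [mul_inv, inv_inv, mul_comm]

theorem CMCSurface.contDiffOn_u {ε δ : ℝ} {X : Type*} [TopologicalSpace X] [ChartedSpace ℂ X]
    (S : CMCSurface ε δ X) {e : OpenPartialHomeomorph X ℂ} (he : e ∈ Charts X) :
    ContDiffOn ℝ ∞ (S.u e) e.target := by
  refine (ContDiffOn.log (Complex.reCLM.contDiff.comp_contDiffOn (S.metric_smooth e he))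
    fun z hz => ?_).div_const 2
  obtain ⟨l, hl, h⟩ := S.metric_pos e he z hz
  simpa [h] using hl.ne'

/-- The normal forms of the formal Killing coefficients and the conservation laws at an umbilic. -/
theorem exists_normalForm (γ : ℂ) (p n : ℕ) :
    ∃ Pa Pb Pc F G : WPoly,
      Pa.IsO (4 * n - 2) ∧ Pb.IsO (4 * n - 4) ∧ Pc.IsO (4 * n - 4) ∧
      F.IsO (4 * n) ∧ G.IsO (4 * n - 4) ∧
      ∀ (u : ℂ → ℝ) (U : Set ℂ), IsOpen U → ContDiffOn ℝ ∞ u U → ∀ w : ℂ, w ≠ 0 → w ^ 2 ∈ U →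
        (1 ≤ n →
          (killing γ (umbilicFrame u) (umbilicRoot p u) n).b w =
              w ^ (-((2 * n - 1) * p + (4 * n - 4) : ℤ)) * Pb.value u w ∧
          (killing γ (umbilicFrame u) (umbilicRoot p u) n).c w =
              w ^ (-((2 * n - 3) * p + (4 * n - 4) : ℤ)) * Pc.value u w ∧
          (killing γ (umbilicFrame u) (umbilicRoot p u) n).a w =
              w ^ (-((2 * n - 1) * p + (4 * n - 2) : ℤ)) * Pa.value u w) ∧
        phiDz γ (umbilicFrame u) (umbilicRoot p u) n w =
            w ^ (-((2 * n - 1) * p + (4 * n - 1) : ℤ)) * F.value u w ∧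
        phiDzbar γ (umbilicFrame u) (umbilicRoot p u) n w =
            w ^ (-((2 * n - 1) * p + (4 * n - 4) : ℤ)) * G.value u w * conj w := by
  have K := killingClass_hasNormalForm p
  obtain ⟨-, -, Q, hQ, eQ⟩ := K.killing γ (n + 1) (by omega)
  have hF : ∀ (u : ℂ → ℝ) (U : Set ℂ), IsOpen U → ContDiffOn ℝ ∞ u U → ∀ w : ℂ, w ≠ 0 →
      w ^ 2 ∈ U → phiDz γ (umbilicFrame u) (umbilicRoot p u) n w =
        w ^ (-((2 * n - 1) * p + (4 * n - 1) : ℤ)) *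
          WPoly.value (Polynomial.C (MvPolynomial.C 2 * MvPolynomial.X .expU) * Q) u w := by
    intro u U hU hu w hw hwU
    have h : (killing γ (umbilicFrame u) (umbilicRoot p u) (n + 1)).c w =
        w ^ (-((2 * n - 1) * p + 4 * n : ℤ)) * Q.value u w := by
      refine (eQ ⟨(u, U), hU, hu⟩ w hw hwU).trans ?_
      congr 2
      simp; ring
    -- The factor `w` in `ξ = 2w e^u dw` lowers the pole order `4n` of `c^{2n+2}` to `4n - 1`.
    have hexp : (-((2 * n - 1) * p + (4 * n - 1) : ℤ)) = -((2 * n - 1) * p + 4 * n) + 1 := by ring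
    rw [phiDz, h, WPoly.value_mul, WPoly.value_C, hexp, zpow_add_one₀ hw]
    simp only [umbilicFrame, map_mul, MvPolynomial.eval_C, MvPolynomial.eval_X, jetValue]
    push_cast
    ring
  have hFO : WPoly.IsO (Polynomial.C (MvPolynomial.C 2 * MvPolynomial.X .expU) * Q) (4 * n) :=
    ((WPoly.isO_C _).mul hQ).mono (by simp; omega)
  rcases Nat.eq_zero_or_pos n with rfl | hn
  -- For `n = 0` the degree bounds on all polynomials except `F` are negative and force them to
  -- vanish, consistently with `b⁰ = 0`.
  · refine ⟨0, 0, 0, _, 0, WPoly.isO_zero _, WPoly.isO_zero _, WPoly.isO_zero _, hFO,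
      WPoly.isO_zero _, fun u U hU hu w hw hwU => ⟨fun h => absurd h (by omega),
        hF u U hU hu w hw hwU, ?_⟩⟩
    simp [phiDzbar, killing, killingTable, WPoly.value_zero]
  · obtain ⟨⟨Pa, hPa, ea⟩, ⟨Pb, hPb, eb⟩, Pc, hPc, ec⟩ := K.killing γ n hn
    have hb : ∀ (u : ℂ → ℝ) (U : Set ℂ), IsOpen U → ContDiffOn ℝ ∞ u U → ∀ w : ℂ, w ≠ 0 →
        w ^ 2 ∈ U → (killing γ (umbilicFrame u) (umbilicRoot p u) n).b w =
          w ^ (-((2 * n - 1) * p + (4 * n - 4) : ℤ)) * Pb.value u w := by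
      intro u U hU hu w hw hwU
      refine (eb ⟨(u, U), hU, hu⟩ w hw hwU).trans ?_
      congr 2
      simp; ring
    refine ⟨Pa, Pb, Pc, _, Polynomial.C (MvPolynomial.C 2 * MvPolynomial.X .expU) * Pb,
      hPa.mono (by simp; omega), hPb.mono (by simp; omega), hPc.mono (by simp; omega), hFO,
      ((WPoly.isO_C _).mul hPb).mono (by simp; omega), fun u U hU hu w hw hwU =>
      ⟨fun _ => ⟨hb u U hU hu w hw hwU, ?_, ?_⟩, hF u U hU hu w hw hwU, ?_⟩⟩
    · refine (ec ⟨(u, U), hU, hu⟩ w hw hwU).trans ?_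
      congr 2
      simp; ring
    · refine (ea ⟨(u, U), hU, hu⟩ w hw hwU).trans ?_
      congr 2
      simp; ring
    · rw [phiDzbar, hb u U hU hu w hw hwU, WPoly.value_mul, WPoly.value_C]
      simp only [umbilicFrame, map_mul, MvPolynomial.eval_X, jetValue,
        Complex.conj_ofReal, map_ofNat]
      ring

/-! ### Smoothness across the zeros of `ω` -/

/-- Functions of the form `t^α s` with `s` smooth on `V`, away from the zeros of `t`. -/
def HasOrder (V : Set ℂ) (t : ℂ → ℂ) (_ : ℤ) (α : ℤ) (f : Unit → ℂ → ℂ) : Prop :=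
  ∃ s : ℂ → ℂ, ContDiffOn ℝ ∞ s V ∧ ∀ ζ ∈ V, t ζ ≠ 0 → f () ζ = t ζ ^ α * s ζ

section HasOrder

variable {V : Set ℂ} {t g q a b : ℂ → ℂ}

/-- Differentiating `t^α` costs one power of `t` and dividing by `g = t^l a` costs `l` more. The
connection form costs nothing: `t^l` is holomorphic, so `g_ζ̄ / g = a_ζ̄ / a` is smooth across the
zeros of `t`. -/
theorem HasOrder.dXi (hV : IsOpen V) (ht : DifferentiableOn ℂ t V) {l : ℕ}
    (ha : ContDiffOn ℝ ∞ a V) (ha0 : ∀ ζ ∈ V, a ζ ≠ 0) (hg : ∀ ζ ∈ V, g ζ = t ζ ^ l * a ζ)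
    {j α : ℤ} {f : Unit → ℂ → ℂ} (hf : HasOrder V t j α f) :
    HasOrder V t (j + 1) (α + -((l : ℤ) + 1)) (fun i => dXi g j (f i)) := by
  obtain ⟨s, hs, h⟩ := hf
  have htr := contDiffOn_real_of_holomorphic hV ht
  have htd := contDiffOn_real_of_holomorphic hV (ht.deriv hV)
  refine ⟨fun ζ => (α * (deriv t ζ * s ζ) + t ζ * dz s ζ -
    j * (t ζ * (conj (dzbar a ζ / a ζ) * s ζ))) / a ζ, ?_, fun ζ hζ htζ => ?_⟩
  · exact contDiffOn_div (((contDiffOn_const.mul (htd.mul hs)).add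
      (htr.mul (contDiffOn_dz hV hs))).sub (contDiffOn_const.mul (htr.mul
        ((contDiffOn_conj (contDiffOn_div (contDiffOn_dzbar hV ha) ha ha0)).mul hs)))) ha ha0
  · have hVn : V ∈ 𝓝 ζ := hV.mem_nhds hζ
    have htζd : DifferentiableAt ℂ t ζ := ht.differentiableAt hVn
    have hzp : DifferentiableAt ℂ (fun y => t y ^ α) ζ := htζd.zpow (Or.inl htζ)
    have hzd : deriv (fun y => t y ^ α) ζ = α * t ζ ^ (α - 1) * deriv t ζ :=
      ((hasDerivAt_zpow α (t ζ) (Or.inl htζ)).comp ζ htζd.hasDerivAt).deriv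
    have hfe : f () =ᶠ[𝓝 ζ] fun y => t y ^ α * s y := by
      filter_upwards [hVn, htζd.continuousAt.eventually_ne htζ] with y hy hty
      exact h y hy hty
    have hge : g =ᶠ[𝓝 ζ] fun y => t y ^ l * a y := by
      filter_upwards [hVn] with y hy
      exact hg y hy
    have hpd : DifferentiableAt ℂ (fun y => t y ^ l) ζ := htζd.pow l
    have hdf : dz (f ()) ζ = α * t ζ ^ (α - 1) * deriv t ζ * s ζ + t ζ ^ α * dz s ζ := by
      rw [dz_congr hfe, dz_mul (hzp.restrictScalars ℝ) (differentiableAt_of_contDiffOn hV hs hζ),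
        dz_of_differentiableAt hzp, hzd]
    have hdg : dzbar g ζ / g ζ = dzbar a ζ / a ζ := by
      rw [dzbar_congr hge, dzbar_mul (hpd.restrictScalars ℝ)
        (differentiableAt_of_contDiffOn hV ha hζ), dzbar_of_differentiableAt hpd, hg ζ hζ,
        zero_mul, zero_add, mul_div_mul_left _ _ (pow_ne_zero l htζ)]
    have haζ := ha0 ζ hζ
    have hpow : t ζ ^ (α + -((l : ℤ) + 1)) = t ζ ^ α / (t ζ ^ l * t ζ) := by
      rw [← sub_eq_add_neg, zpow_sub₀ htζ, zpow_add_one₀ htζ, zpow_natCast]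
    simp only [CMCUmbilic.dXi]
    rw [hdf, hdg, h ζ hζ htζ, hg ζ hζ, hpow, zpow_sub_one₀ htζ]
    field_simp

theorem killingClass_hasOrder (hV : IsOpen V) (ht : DifferentiableOn ℂ t V) {l : ℕ} {k : ℤ}
    (ha : ContDiffOn ℝ ∞ a V) (ha0 : ∀ ζ ∈ V, a ζ ≠ 0) (hg : ∀ ζ ∈ V, g ζ = t ζ ^ l * a ζ)
    (hb : ContDiffOn ℝ ∞ b V) (hb0 : ∀ ζ ∈ V, b ζ ≠ 0)
    (hq : ∀ ζ ∈ V, t ζ ≠ 0 → q ζ = t ζ ^ k * b ζ) :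
    KillingClass (fun _ : Unit => g) (fun _ => q) k (-((l : ℤ) + 1)) (HasOrder V t) where
  zero j α := ⟨fun _ => 0, contDiffOn_const, fun ζ _ _ => (mul_zero _).symm⟩
  add := by
    rintro j α f h ⟨s, hs, e⟩ ⟨s', hs', e'⟩
    exact ⟨_, hs.add hs', fun ζ hζ htζ => by simp only [e ζ hζ htζ, e' ζ hζ htζ, mul_add]⟩
  const_mul := by
    rintro j α f c ⟨s, hs, e⟩
    exact ⟨_, contDiffOn_const.mul hs, fun ζ hζ htζ => by
      simp only [e ζ hζ htζ]; exact mul_left_comm _ _ _⟩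
  mul := by
    rintro j α f k β h ⟨s, hs, e⟩ ⟨s', hs', e'⟩
    exact ⟨_, hs.mul hs', fun ζ hζ htζ => by
      simp only [e ζ hζ htζ, e' ζ hζ htζ, zpow_add₀ htζ]; ring⟩
  deriv := HasOrder.dXi hV ht ha ha0 hg
  root := ⟨b, hb, hq⟩
  root_inv := ⟨_, hb.fun_inv hb0, fun ζ hζ htζ => by
    simp only [hq ζ hζ htζ, mul_inv, zpow_neg]⟩

/-- `φ_n ⊗ ω^{4n}` extends smoothly across a zero of `ω`. -/
theorem exists_smooth_phi {c : ℂ → ℂ} {om : ℂ → ℂ} (hV : IsOpen V) (ht : DifferentiableOn ℂ t V)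
    {l m : ℕ} (ha : ContDiffOn ℝ ∞ a V) (ha0 : ∀ ζ ∈ V, a ζ ≠ 0)
    (hg : ∀ ζ ∈ V, g ζ = t ζ ^ l * a ζ) (hc : ContDiffOn ℝ ∞ c V) (hc0 : ∀ ζ ∈ V, c ζ ≠ 0)
    (hom : ∀ ζ ∈ V, om ζ = t ζ ^ m * c ζ) (hq : ∀ ζ ∈ V, q ζ = om ζ / g ζ)
    (hm : 1 ≤ m ∨ ∀ ζ ∈ V, t ζ = 1) (γ : ℂ) (n : ℕ) :
    ∃ s s' : ℂ → ℂ, ContDiffOn ℝ ∞ s V ∧ ContDiffOn ℝ ∞ s' V ∧ ∀ ζ ∈ V, t ζ ≠ 0 →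
      phiDz γ g q n ζ * om ζ ^ (4 * n) = s ζ ∧ phiDzbar γ g q n ζ * om ζ ^ (4 * n) = s' ζ := by
  have htr := contDiffOn_real_of_holomorphic hV ht
  have K := killingClass_hasOrder (k := (m : ℤ) - l) hV ht ha ha0 hg
    (contDiffOn_div hc ha ha0)
    (fun ζ hζ => div_ne_zero (hc0 ζ hζ) (ha0 ζ hζ)) (q := q) (fun ζ hζ htζ => by
      rw [hq ζ hζ, hom ζ hζ, hg ζ hζ, zpow_sub₀ htζ, zpow_natCast, zpow_natCast, div_mul_div_comm])
  -- A natural power is smooth at the zeros of `t` too. When `t = 1` the exponent may be negative,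
  -- but the truncation by `toNat` is harmless.
  have hnat : ∀ e : ℤ, (1 ≤ m → 0 ≤ e) → ∀ ζ ∈ V, t ζ ≠ 0 → t ζ ^ e = t ζ ^ e.toNat := by
    intro e he ζ hζ htζ
    rcases hm with hm | hm
    · rw [← zpow_natCast, Int.toNat_of_nonneg (he hm)]
    · rw [hm ζ hζ, one_zpow, one_pow]
  obtain ⟨-, -, s, hs, es⟩ := K.killing γ (n + 1) (by omega)
  have hDz : ∀ ζ ∈ V, t ζ ≠ 0 → phiDz γ g q n ζ * om ζ ^ (4 * n) =
      t ζ ^ ((2 * n + 1) * m - 2 * n : ℤ).toNat * (s ζ * a ζ * c ζ ^ (4 * n)) := by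
    intro ζ hζ htζ
    -- The right side adds the orders of `c^{2n+2}`, of `ξ` and of `ω^{4n}`; the ramification number
    -- `l` drops out.
    have he : ((2 * n + 1) * m - 2 * n : ℤ) = (2 * (n + 1 : ℕ) - 2 : ℤ) • (-((l : ℤ) + 1)) -
        (2 * (n + 1 : ℕ) - 3 : ℤ) • ((m : ℤ) - l) + l + m * (4 * n : ℕ) := by
      simp only [smul_eq_mul]; push_cast; ring
    rw [← hnat _ (fun hm => by nlinarith) ζ hζ htζ, phiDz,
      show (killing γ g q (n + 1)).c ζ = _ from es ζ hζ htζ, hg ζ hζ, hom ζ hζ, he,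
      zpow_add₀ htζ, zpow_add₀ htζ, zpow_mul, zpow_natCast, zpow_natCast, zpow_natCast]
    ring
  have hDz' : ContDiffOn ℝ ∞ (fun ζ => t ζ ^ ((2 * n + 1) * m - 2 * n : ℤ).toNat *
      (s ζ * a ζ * c ζ ^ (4 * n))) V :=
    (htr.pow _).mul ((hs.mul ha).mul (hc.pow _))
  rcases Nat.eq_zero_or_pos n with rfl | hn
  · refine ⟨_, fun _ => 0, hDz', contDiffOn_const, fun ζ hζ htζ => ⟨hDz ζ hζ htζ, ?_⟩⟩
    simp [phiDzbar, killing, killingTable]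
  · obtain ⟨-, ⟨s', hs', es'⟩, -⟩ := K.killing γ n hn
    refine ⟨_, fun ζ => t ζ ^ ((2 * n + 1) * m + l - 2 * n + 2 : ℤ).toNat *
      (s' ζ * (conj (t ζ) ^ l * conj (a ζ)) * c ζ ^ (4 * n)), hDz',
      (htr.pow _).mul ((hs'.mul (((contDiffOn_conj htr).pow _).mul (contDiffOn_conj ha))).mul
        (hc.pow _)), fun ζ hζ htζ => ⟨hDz ζ hζ htζ, ?_⟩⟩
    have he : ((2 * n + 1) * m + l - 2 * n + 2 : ℤ) = (2 * n - 2 : ℤ) • (-((l : ℤ) + 1)) -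
        (2 * n - 1 : ℤ) • ((m : ℤ) - l) + m * (4 * n : ℕ) := by
      simp only [smul_eq_mul]; push_cast; ring
    beta_reduce
    rw [← hnat _ (fun hm => by nlinarith) ζ hζ htζ, phiDzbar,
      show (killing γ g q n).b ζ = _ from es' ζ hζ htζ, hg ζ hζ, hom ζ hζ, he,
      zpow_add₀ htζ, zpow_mul, zpow_natCast, zpow_natCast, map_mul, map_pow]
    ring

end HasOrder

/-! ### Independence of the coordinates -/

/-- Smooth functions `f false` on `V false`, `f true` on `V true` with `f true = λ^{-j} τ^* f false`:
functions of weight `j` with respect to two frames which are related by the coordinate change `τ`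
and the rotation by `λ`. -/
def IsEquivariant (V : Bool → Set ℂ) (τ lam : ℂ → ℂ) (j : ℤ) (_ : ℤ) (f : Bool → ℂ → ℂ) : Prop :=
  (∀ i, ContDiffOn ℝ ∞ (f i) (V i)) ∧ ∀ ζ ∈ V true, f true ζ = lam ζ ^ (-j) * f false (τ ζ)

section IsEquivariant

variable {V : Bool → Set ℂ} {τ lam : ℂ → ℂ} {g q : Bool → ℂ → ℂ}

theorem contDiffOn_dXi {W : Set ℂ} {G f : ℂ → ℂ} (hW : IsOpen W) (hG : ContDiffOn ℝ ∞ G W)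
    (hG0 : ∀ ζ ∈ W, G ζ ≠ 0) (hf : ContDiffOn ℝ ∞ f W) (j : ℤ) :
    ContDiffOn ℝ ∞ (dXi G j f) W :=
  contDiffOn_div ((contDiffOn_dz hW hf).sub ((contDiffOn_const.mul
    (contDiffOn_conj (contDiffOn_div (contDiffOn_dzbar hW hG) hG hG0))).mul hf)) hG hG0

/-- Obtained by applying `∂/∂z` to `λ λ̄ = 1`. It makes the connection form absorb the rotation of
the frame. -/
theorem dz_div_self_of_unit {W : Set ℂ} (hW : IsOpen W) (hl : ContDiffOn ℝ ∞ lam W)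
    (hl1 : ∀ ζ ∈ W, lam ζ * conj (lam ζ) = 1) {ζ : ℂ} (hζ : ζ ∈ W) :
    dz lam ζ / lam ζ = -conj (dzbar lam ζ / lam ζ) := by
  have h0 : lam ζ ≠ 0 := left_ne_zero_of_mul (hl1 ζ hζ ▸ one_ne_zero)
  have h0' : conj (lam ζ) ≠ 0 := (map_ne_zero _).mpr h0
  have hd := differentiableAt_of_contDiffOn hW hl hζ
  have hev : (fun y => lam y * conj (lam y)) =ᶠ[𝓝 ζ] fun _ => 1 := by
    filter_upwards [hW.mem_nhds hζ] with y hy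
    exact hl1 y hy
  have h := dz_congr hev
  rw [dz_const, dz_mul hd (differentiableAt_of_contDiffOn hW (contDiffOn_conj hl) hζ),
    dz_conj hd] at h
  rw [map_div₀]
  field_simp
  linear_combination h

/-- The Leibniz rule for `λ^{-j}` produces `-j λ_ζ/λ`, and the new connection form produces `-j
conj(λ_ζ̄/λ)`. These cancel because `|λ| = 1`, and dividing by the rotated frame accounts for the
additional `λ^{-1}`. -/
theorem IsEquivariant.dXi (hV : ∀ i, IsOpen (V i)) (hτ : DifferentiableOn ℂ τ (V true))
    (hτ0 : ∀ ζ ∈ V true, deriv τ ζ ≠ 0) (hmap : Set.MapsTo τ (V true) (V false))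
    (hl : ContDiffOn ℝ ∞ lam (V true)) (hl1 : ∀ ζ ∈ V true, lam ζ * conj (lam ζ) = 1)
    (hg : ∀ i, ContDiffOn ℝ ∞ (g i) (V i)) (hg0 : ∀ i, ∀ ζ ∈ V i, g i ζ ≠ 0)
    (hgτ : ∀ ζ ∈ V true, g true ζ = lam ζ * (g false (τ ζ) * deriv τ ζ))
    {j α β : ℤ} {f : Bool → ℂ → ℂ} (hf : IsEquivariant V τ lam j α f) :
    IsEquivariant V τ lam (j + 1) β (fun i => dXi (g i) j (f i)) := by
  refine ⟨fun i => contDiffOn_dXi (hV i) (hg i) (hg0 i) (hf.1 i) j, fun ζ hζ => ?_⟩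
  have hVn := (hV true).mem_nhds hζ
  have h0 : lam ζ ≠ 0 := left_ne_zero_of_mul (hl1 ζ hζ ▸ one_ne_zero)
  have hτd : DifferentiableAt ℂ τ ζ := hτ.differentiableAt hVn
  have hτ'd : DifferentiableAt ℂ (deriv τ) ζ := (hτ.deriv (hV true)).differentiableAt hVn
  have hld := differentiableAt_of_contDiffOn (hV true) hl hζ
  have hfd := differentiableAt_of_contDiffOn (hV false) (hf.1 false) (hmap hζ)
  have hgd := differentiableAt_of_contDiffOn (hV false) (hg false) (hmap hζ)
  have hfτ : DifferentiableAt ℝ (fun y => f false (τ y)) ζ :=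
    hfd.comp ζ (hτd.restrictScalars ℝ)
  have hgτd : DifferentiableAt ℝ (fun y => g false (τ y)) ζ :=
    hgd.comp ζ (hτd.restrictScalars ℝ)
  have hz : DifferentiableAt ℂ (fun y : ℂ => y ^ (-j)) (lam ζ) :=
    differentiableAt_zpow.mpr (Or.inl h0)
  have hlz : DifferentiableAt ℝ (fun y => lam y ^ (-j)) ζ :=
    (hz.restrictScalars ℝ).comp ζ hld
  have hfe : f true =ᶠ[𝓝 ζ] fun y => lam y ^ (-j) * f false (τ y) := by
    filter_upwards [hVn] with y hy using hf.2 y hy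
  have hge : g true =ᶠ[𝓝 ζ] fun y => lam y * (g false (τ y) * deriv τ y) := by
    filter_upwards [hVn] with y hy using hgτ y hy
  have hgn := hg0 false _ (hmap hζ)
  have hτn := hτ0 ζ hζ
  have hdg : dzbar (g true) ζ / g true ζ = dzbar lam ζ / lam ζ +
      dzbar (g false) (τ ζ) / g false (τ ζ) * conj (deriv τ ζ) := by
    rw [dzbar_congr hge, dzbar_mul hld (hgτd.fun_mul (hτ'd.restrictScalars ℝ)),
      dzbar_mul hgτd (hτ'd.restrictScalars ℝ), dzbar_of_differentiableAt hτ'd,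
      dzbar_comp hgd hτd, hgτ ζ hζ]
    field_simp
    ring
  have hdf : dz (f true) ζ = lam ζ ^ (-j) * (-j * (dz lam ζ / lam ζ) * f false (τ ζ) +
      dz (f false) (τ ζ) * deriv τ ζ) := by
    rw [dz_congr hfe, dz_mul hlz hfτ, dz_holomorphic_comp (h := fun y => y ^ (-j)) hz hld,
      dz_comp hfd hτd, deriv_zpow, zpow_sub_one₀ h0]
    push_cast
    field_simp
  simp only [CMCUmbilic.dXi]
  rw [hdf, hdg, dz_div_self_of_unit (hV true) hl hl1 hζ, hf.2 ζ hζ, hgτ ζ hζ, map_add, map_mul,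
    Complex.conj_conj, neg_add, zpow_add₀ h0, zpow_neg_one]
  field_simp
  ring

/-- Only the weight matters here, so all degrees are irrelevant and set to `0`. `h₂^{1/2}` picks up
`λ^{-1}` because `ω = h₂^{1/2} ξ` is independent of the frame. -/
theorem killingClass_isEquivariant (hV : ∀ i, IsOpen (V i)) (hτ : DifferentiableOn ℂ τ (V true))
    (hτ0 : ∀ ζ ∈ V true, deriv τ ζ ≠ 0) (hmap : Set.MapsTo τ (V true) (V false))
    (hl : ContDiffOn ℝ ∞ lam (V true)) (hl1 : ∀ ζ ∈ V true, lam ζ * conj (lam ζ) = 1)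
    (hg : ∀ i, ContDiffOn ℝ ∞ (g i) (V i)) (hg0 : ∀ i, ∀ ζ ∈ V i, g i ζ ≠ 0)
    (hgτ : ∀ ζ ∈ V true, g true ζ = lam ζ * (g false (τ ζ) * deriv τ ζ))
    (hq : ∀ i, ContDiffOn ℝ ∞ (q i) (V i)) (hq0 : ∀ i, ∀ ζ ∈ V i, q i ζ ≠ 0)
    (hqτ : ∀ ζ ∈ V true, q true ζ = (lam ζ)⁻¹ * q false (τ ζ)) :
    KillingClass g q 0 0 (IsEquivariant V τ lam) where
  zero j α := ⟨fun _ => contDiffOn_const, fun _ _ => (mul_zero _).symm⟩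
  add hf hh := ⟨fun i => (hf.1 i).add (hh.1 i), fun ζ hζ => by
    simp only [hf.2 ζ hζ, hh.2 ζ hζ, mul_add]⟩
  const_mul c hf := ⟨fun i => contDiffOn_const.mul (hf.1 i), fun ζ hζ => by
    simp only [hf.2 ζ hζ, mul_left_comm]⟩
  mul hf hh := ⟨fun i => (hf.1 i).mul (hh.1 i), fun ζ hζ => by
    have h0 : lam ζ ≠ 0 := left_ne_zero_of_mul (hl1 ζ hζ ▸ one_ne_zero)
    simp only [hf.2 ζ hζ, hh.2 ζ hζ, neg_add, zpow_add₀ h0]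
    ring⟩
  deriv hf := hf.dXi hV hτ hτ0 hmap hl hl1 hg hg0 hgτ
  root := ⟨hq, fun ζ hζ => by rw [hqτ ζ hζ, zpow_neg_one]⟩
  root_inv := ⟨fun i => (hq i).fun_inv (hq0 i), fun ζ hζ => by
    simp only [hqτ ζ hζ, neg_neg, zpow_one, mul_inv, inv_inv]⟩

/-- The conservation laws `φ_n` do not depend on the choice of the coordinate and the frame. -/
theorem phi_comp (hV : ∀ i, IsOpen (V i)) (hτ : DifferentiableOn ℂ τ (V true))
    (hτ0 : ∀ ζ ∈ V true, deriv τ ζ ≠ 0) (hmap : Set.MapsTo τ (V true) (V false))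
    (hl : ContDiffOn ℝ ∞ lam (V true)) (hl1 : ∀ ζ ∈ V true, lam ζ * conj (lam ζ) = 1)
    (hg : ∀ i, ContDiffOn ℝ ∞ (g i) (V i)) (hg0 : ∀ i, ∀ ζ ∈ V i, g i ζ ≠ 0)
    (hgτ : ∀ ζ ∈ V true, g true ζ = lam ζ * (g false (τ ζ) * deriv τ ζ))
    (hq : ∀ i, ContDiffOn ℝ ∞ (q i) (V i)) (hq0 : ∀ i, ∀ ζ ∈ V i, q i ζ ≠ 0)
    (hqτ : ∀ ζ ∈ V true, q true ζ = (lam ζ)⁻¹ * q false (τ ζ)) (γ : ℂ) (n : ℕ)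
    {ζ : ℂ} (hζ : ζ ∈ V true) :
    phiDz γ (g true) (q true) n ζ = phiDz γ (g false) (q false) n (τ ζ) * deriv τ ζ ∧
    phiDzbar γ (g true) (q true) n ζ =
      phiDzbar γ (g false) (q false) n (τ ζ) * conj (deriv τ ζ) := by
  have K := killingClass_isEquivariant hV hτ hτ0 hmap hl hl1 hg hg0 hgτ hq hq0 hqτ
  have h0 : lam ζ ≠ 0 := left_ne_zero_of_mul (hl1 ζ hζ ▸ one_ne_zero)
  constructor
  · have h : (killing γ (g true) (q true) (n + 1)).c ζ = _ :=
      (K.killing γ (n + 1) (by omega)).2.2.2 ζ hζ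
    rw [phiDz, phiDz, h, hgτ ζ hζ, zpow_neg_one]
    field_simp
  · rcases Nat.eq_zero_or_pos n with rfl | hn
    · simp [phiDzbar, killing, killingTable]
    · have h : (killing γ (g true) (q true) n).b ζ = _ := (K.killing γ n hn).2.1.2 ζ hζ
      rw [phiDzbar, phiDzbar, h, hgτ ζ hζ, neg_neg, zpow_one, map_mul, map_mul]
      linear_combination ((killing γ (g false) (q false) n).b (τ ζ) *
        conj (g false (τ ζ)) * conj (deriv τ ζ)) * hl1 ζ hζ

end IsEquivariant

/-! ### Holomorphic maps in local coordinates -/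

section Coordinates

variable {X Y Z : Type*} [TopologicalSpace X] [TopologicalSpace Y] [TopologicalSpace Z]

theorem isOpen_coordDomain {f : Y → X} (hf : Continuous f) (e' : OpenPartialHomeomorph Y ℂ)
    (e : OpenPartialHomeomorph X ℂ) : IsOpen (e'.target ∩ e'.symm ⁻¹' (f ⁻¹' e.source)) :=
  e'.isOpen_inter_preimage_symm (e.open_source.preimage hf)

theorem deriv_coord_self {e' : OpenPartialHomeomorph Y ℂ} {y : Y}
    (hy : y ∈ e'.source) : deriv (fun ζ => e' (e'.symm ζ)) (e' y) = 1 := by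
  have hev : (fun ζ => e' (e'.symm ζ)) =ᶠ[𝓝 (e' y)] fun ζ => ζ := by
    filter_upwards [e'.open_target.mem_nhds (e'.map_source hy)] with ζ hζ using e'.right_inv hζ
  rw [hev.deriv_eq, deriv_id'']

variable [ChartedSpace ℂ X] [ChartedSpace ℂ Y] [ChartedSpace ℂ Z]

theorem differentiableOn_coord {f : Y → X} (hf : ContMDiff 𝓘(ℂ) 𝓘(ℂ) ω f)
    {e' : OpenPartialHomeomorph Y ℂ} (he' : e' ∈ Charts Y) {e : OpenPartialHomeomorph X ℂ}
    (he : e ∈ Charts X) : DifferentiableOn ℂ (fun ζ => e (f (e'.symm ζ)))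
      (e'.target ∩ e'.symm ⁻¹' (f ⁻¹' e.source)) := by
  have h1 : ContMDiffOn 𝓘(ℂ) 𝓘(ℂ) ω (fun ζ => f (e'.symm ζ)) e'.target :=
    hf.comp_contMDiffOn (contMDiffOn_symm_of_mem_maximalAtlas he')
  have h2 : ContMDiffOn 𝓘(ℂ) 𝓘(ℂ) ω (fun ζ => e (f (e'.symm ζ)))
      (e'.target ∩ e'.symm ⁻¹' (f ⁻¹' e.source)) :=
    (contMDiffOn_of_mem_maximalAtlas he).comp (h1.mono Set.inter_subset_left) fun ζ hζ => hζ.2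
  exact (contMDiffOn_iff_contDiffOn.mp h2).differentiableOn (by simp)

theorem differentiableAt_coord {f : Y → X} (hf : ContMDiff 𝓘(ℂ) 𝓘(ℂ) ω f)
    {e' : OpenPartialHomeomorph Y ℂ} (he' : e' ∈ Charts Y) {e : OpenPartialHomeomorph X ℂ}
    (he : e ∈ Charts X) {y : Y} (hy : y ∈ e'.source) (hx : f y ∈ e.source) :
    DifferentiableAt ℂ (fun ζ => e (f (e'.symm ζ))) (e' y) :=
  (differentiableOn_coord hf he' he).differentiableAt
    ((isOpen_coordDomain hf.continuous e' e).mem_nhds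
      ⟨e'.map_source hy, by simpa [e'.left_inv hy] using hx⟩)

/-- The chain rule in local coordinates. -/
theorem deriv_coord_comp {f : Y → X} {h : X → Z} (hf : ContMDiff 𝓘(ℂ) 𝓘(ℂ) ω f)
    (hh : ContMDiff 𝓘(ℂ) 𝓘(ℂ) ω h) {e' : OpenPartialHomeomorph Y ℂ} (he' : e' ∈ Charts Y)
    {e : OpenPartialHomeomorph X ℂ} (he : e ∈ Charts X) {d : OpenPartialHomeomorph Z ℂ}
    (hd : d ∈ Charts Z) {y : Y} (hy : y ∈ e'.source) (hx : f y ∈ e.source)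
    (hz : h (f y) ∈ d.source) :
    deriv (fun ζ => d (h (f (e'.symm ζ)))) (e' y) =
      deriv (fun z => d (h (e.symm z))) (e (f y)) * deriv (fun ζ => e (f (e'.symm ζ))) (e' y) := by
  have hd1 := differentiableAt_coord hf he' he hy hx
  have hd2 := differentiableAt_coord hh he hd hx hz
  have hev : (fun ζ => d (h (f (e'.symm ζ)))) =ᶠ[𝓝 (e' y)]
      (fun z => d (h (e.symm z))) ∘ fun ζ => e (f (e'.symm ζ)) := by
    filter_upwards [(isOpen_coordDomain hf.continuous e' e).mem_nhds
      ⟨e'.map_source hy, by simpa [e'.left_inv hy] using hx⟩] with ζ hζ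
    simp only [Function.comp, e.left_inv hζ.2]
  have he'y : e (f (e'.symm (e' y))) = e (f y) := by rw [e'.left_inv hy]
  rw [hev.deriv_eq, deriv_comp _ (by rw [he'y]; exact hd2) hd1, he'y]

/-- The chain rule along `e'`, `e''` and back to `e'` exhibits the derivative as a factor of `1`. -/
theorem deriv_transition_ne_zero {e' e'' : OpenPartialHomeomorph Y ℂ} (he' : e' ∈ Charts Y)
    (he'' : e'' ∈ Charts Y) {y : Y} (hy : y ∈ e'.source) (hy' : y ∈ e''.source) :
    deriv (fun ζ => e'' (e'.symm ζ)) (e' y) ≠ 0 := by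
  have h := deriv_coord_comp (f := id) (h := id) contMDiff_id contMDiff_id he' he'' he' hy hy' hy
  simp only [id] at h
  rw [deriv_coord_self hy] at h
  exact right_ne_zero_of_mul (h ▸ one_ne_zero)

end Coordinates

theorem CMCSurface.exp_u_mul_self {ε δ : ℝ} {X : Type*} [TopologicalSpace X] [ChartedSpace ℂ X]
    (S : CMCSurface ε δ X) {e : OpenPartialHomeomorph X ℂ} (he : e ∈ Charts X) {z : ℂ}
    (hz : z ∈ e.target) :
    (Real.exp (S.u e z) : ℂ) * Real.exp (S.u e z) = S.metric.coeff e z := by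
  obtain ⟨l, hl, h⟩ := S.metric_pos e he z hz
  rw [← Complex.ofReal_mul, ← Real.exp_add, CMCSurface.u, h, Complex.ofReal_re, add_halves,
    Real.exp_log hl]

/-! ### The double cover in local coordinates -/

namespace DoubleCover

variable {ε δ : ℝ} {X Y : Type*} [TopologicalSpace X] [ChartedSpace ℂ X]
  [TopologicalSpace Y] [ChartedSpace ℂ Y] {S : CMCSurface ε δ X} (C : DoubleCover S Y)

/-- The coordinate `e` of the surface as a function of the coordinate `e'` of the double cover. -/
def coord (e' : OpenPartialHomeomorph Y ℂ) (e : OpenPartialHomeomorph X ℂ) : ℂ → ℂ :=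
  fun ζ => e (C.proj (e'.symm ζ))

/-- The unit form `ξ = e^u dz` in the coordinate `e'`, where `z = e`. -/
def frame (e' : OpenPartialHomeomorph Y ℂ) (e : OpenPartialHomeomorph X ℂ) : ℂ → ℂ :=
  fun ζ => (Real.exp (S.u e (C.coord e' e ζ)) : ℂ) * deriv (C.coord e' e) ζ

/-- The square root `h₂^{1/2} = ω / ξ`. -/
def root (e' : OpenPartialHomeomorph Y ℂ) (e : OpenPartialHomeomorph X ℂ) : ℂ → ℂ :=
  fun ζ => C.omega.coeff e' ζ / C.frame e' e ζ

/-- The common domain of the coordinates `e'` and `e`. -/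
def domain (e' : OpenPartialHomeomorph Y ℂ) (e : OpenPartialHomeomorph X ℂ) : Set ℂ :=
  e'.target ∩ e'.symm ⁻¹' (C.proj ⁻¹' e.source)

variable {e' e'₁ e'₂ : OpenPartialHomeomorph Y ℂ} {e e₁ e₂ : OpenPartialHomeomorph X ℂ}

theorem isOpen_domain : IsOpen (C.domain e' e) :=
  isOpen_coordDomain C.proj_holomorphic.continuous e' e

theorem coord_mem_target {ζ : ℂ} (hζ : ζ ∈ C.domain e' e) : C.coord e' e ζ ∈ e.target :=
  e.map_source hζ.2

theorem differentiableOn_coord (he' : e' ∈ Charts Y) (he : e ∈ Charts X) :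
    DifferentiableOn ℂ (C.coord e' e) (C.domain e' e) :=
  CMCUmbilic.differentiableOn_coord C.proj_holomorphic he' he

theorem contDiffOn_exp_u (he' : e' ∈ Charts Y) (he : e ∈ Charts X) :
    ContDiffOn ℝ ∞ (fun ζ => (Real.exp (S.u e (C.coord e' e ζ)) : ℂ)) (C.domain e' e) :=
  contDiffOn_ofReal ((S.contDiffOn_u he).comp
    (contDiffOn_real_of_holomorphic C.isOpen_domain (C.differentiableOn_coord he' he))
    fun _ hζ => C.coord_mem_target hζ).exp

theorem contDiffOn_frame (he' : e' ∈ Charts Y) (he : e ∈ Charts X) :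
    ContDiffOn ℝ ∞ (C.frame e' e) (C.domain e' e) :=
  (C.contDiffOn_exp_u he' he).mul (contDiffOn_real_of_holomorphic C.isOpen_domain
    ((C.differentiableOn_coord he' he).deriv C.isOpen_domain))

theorem contDiffOn_omega (he' : e' ∈ Charts Y) :
    ContDiffOn ℝ ∞ (C.omega.coeff e') e'.target :=
  contDiffOn_real_of_holomorphic e'.open_target (C.omega_holomorphic e' he')

/-- `ξ` has unit length for the pulled back metric; this is what forces two such frames to differ by
a rotation. -/
theorem frame_mul_conj (he : e ∈ Charts X) {ζ : ℂ} (hζ : ζ ∈ C.domain e' e) :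
    C.frame e' e ζ * conj (C.frame e' e ζ) = S.metric.coeff e (C.coord e' e ζ) *
      (deriv (C.coord e' e) ζ * conj (deriv (C.coord e' e) ζ)) := by
  rw [← S.exp_u_mul_self he (C.coord_mem_target hζ), frame, map_mul, Complex.conj_ofReal]
  ring

theorem omega_sq_coord (he' : e' ∈ Charts Y) (he : e ∈ Charts X) {ζ : ℂ}
    (hζ : ζ ∈ C.domain e' e) : C.omega.coeff e' ζ ^ 2 =
      S.hopf.coeff e (C.coord e' e ζ) * deriv (C.coord e' e) ζ ^ 2 := by
  have h := C.omega_sq e' he' e he (e'.symm ζ) (e'.map_target hζ.1) hζ.2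
  rwa [e'.right_inv hζ.1] at h

/-- Branch points of the projection are zeros of `ω`, since `ω² = proj^* II`. -/
theorem deriv_coord_ne_zero (he' : e' ∈ Charts Y) (he : e ∈ Charts X) {ζ : ℂ}
    (hζ : ζ ∈ C.domain e' e) (h0 : C.omega.coeff e' ζ ≠ 0) : deriv (C.coord e' e) ζ ≠ 0 := by
  intro h
  have := C.omega_sq_coord he' he hζ
  rw [h, zero_pow two_ne_zero, mul_zero] at this
  exact h0 (pow_eq_zero_iff two_ne_zero |>.mp this)

theorem frame_ne_zero (he' : e' ∈ Charts Y) (he : e ∈ Charts X) {ζ : ℂ}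
    (hζ : ζ ∈ C.domain e' e) (h0 : C.omega.coeff e' ζ ≠ 0) : C.frame e' e ζ ≠ 0 :=
  mul_ne_zero (Complex.ofReal_ne_zero.mpr (Real.exp_ne_zero _))
    (C.deriv_coord_ne_zero he' he hζ h0)

theorem omega_transform (he'₁ : e'₁ ∈ Charts Y) (he'₂ : e'₂ ∈ Charts Y) {y : Y}
    (hy₁ : y ∈ e'₁.source) (hy₂ : y ∈ e'₂.source) : C.omega.coeff e'₁ (e'₁ y) =
      C.omega.coeff e'₂ (e'₂ y) * deriv (fun z => e'₂ (e'₁.symm z)) (e'₁ y) := by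
  simpa using C.omega.transform e'₁ he'₁ e'₂ he'₂ y hy₁ hy₂

/-- Both sides are the pulled back metric in the coordinate `e'₁`. The map from `e'₁` to `e₂`
factors through `e'₂` and through `e₁`, and comparing the two chain rules reduces the claim to the
transformation law of the metric. -/
theorem frame_mul_conj_transform (he'₁ : e'₁ ∈ Charts Y) (he'₂ : e'₂ ∈ Charts Y)
    (he₁ : e₁ ∈ Charts X) (he₂ : e₂ ∈ Charts X) {y : Y} (hy₁ : y ∈ e'₁.source)
    (hy₂ : y ∈ e'₂.source) (hx₁ : C.proj y ∈ e₁.source) (hx₂ : C.proj y ∈ e₂.source) :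
    C.frame e'₁ e₁ (e'₁ y) * conj (C.frame e'₁ e₁ (e'₁ y)) =
      C.frame e'₂ e₂ (e'₂ y) * deriv (fun z => e'₂ (e'₁.symm z)) (e'₁ y) *
        conj (C.frame e'₂ e₂ (e'₂ y) * deriv (fun z => e'₂ (e'₁.symm z)) (e'₁ y)) := by
  have hP := C.proj_holomorphic
  have h1 := deriv_coord_comp (f := id) (h := C.proj) contMDiff_id hP he'₁ he'₂ he₂ hy₁ hy₂ hx₂
  have h2 := deriv_coord_comp (f := C.proj) (h := id) hP contMDiff_id he'₁ he₁ he₂ hy₁ hx₁ hx₂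
  have hm := S.metric.transform e₁ he₁ e₂ he₂ _ hx₁ hx₂
  have d1 : e'₁ y ∈ C.domain e'₁ e₁ :=
    ⟨e'₁.map_source hy₁, by simpa [e'₁.left_inv hy₁] using hx₁⟩
  have d2 : e'₂ y ∈ C.domain e'₂ e₂ :=
    ⟨e'₂.map_source hy₂, by simpa [e'₂.left_inv hy₂] using hx₂⟩
  have c1 : C.coord e'₁ e₁ (e'₁ y) = e₁ (C.proj y) := by rw [coord, e'₁.left_inv hy₁]
  have c2 : C.coord e'₂ e₂ (e'₂ y) = e₂ (C.proj y) := by rw [coord, e'₂.left_inv hy₂]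
  have h3 : deriv (C.coord e'₂ e₂) (e'₂ y) * deriv (fun z => e'₂ (e'₁.symm z)) (e'₁ y) =
      deriv (fun z => e₂ (e₁.symm z)) (e₁ (C.proj y)) * deriv (C.coord e'₁ e₁) (e'₁ y) :=
    h1.symm.trans h2
  rw [map_mul, mul_mul_mul_comm, C.frame_mul_conj he₁ d1, C.frame_mul_conj he₂ d2, c1, c2, hm,
    pow_one, pow_one]
  have h4 := congrArg conj h3
  rw [map_mul, map_mul] at h4
  linear_combination (-S.metric.coeff e₂ (e₂ (C.proj y)) *
    conj (deriv (C.coord e'₂ e₂) (e'₂ y)) *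
    conj (deriv (fun z => e'₂ (e'₁.symm z)) (e'₁ y))) * h3 -
    (S.metric.coeff e₂ (e₂ (C.proj y)) * deriv (fun z => e₂ (e₁.symm z)) (e₁ (C.proj y)) *
      deriv (C.coord e'₁ e₁) (e'₁ y)) * h4

/-- Away from the zeros of `ω` the conservation laws `φ_n` are well defined 1-forms. -/
theorem phi_transform (he'₁ : e'₁ ∈ Charts Y) (he'₂ : e'₂ ∈ Charts Y)
    (he₁ : e₁ ∈ Charts X) (he₂ : e₂ ∈ Charts X) {y : Y} (hy₁ : y ∈ e'₁.source)
    (hy₂ : y ∈ e'₂.source) (hx₁ : C.proj y ∈ e₁.source) (hx₂ : C.proj y ∈ e₂.source)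
    (h0 : C.omega.coeff e'₁ (e'₁ y) ≠ 0) (γ : ℂ) (n : ℕ) :
    phiDz γ (C.frame e'₁ e₁) (C.root e'₁ e₁) n (e'₁ y) =
      phiDz γ (C.frame e'₂ e₂) (C.root e'₂ e₂) n (e'₂ y) *
        deriv (fun z => e'₂ (e'₁.symm z)) (e'₁ y) ∧
    phiDzbar γ (C.frame e'₁ e₁) (C.root e'₁ e₁) n (e'₁ y) =
      phiDzbar γ (C.frame e'₂ e₂) (C.root e'₂ e₂) n (e'₂ y) *
        conj (deriv (fun z => e'₂ (e'₁.symm z)) (e'₁ y)) := by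
  have hcont := C.proj_holomorphic.continuous
  let τ : ℂ → ℂ := fun z => e'₂ (e'₁.symm z)
  -- The rotation between the two frames is their quotient; on the sets below, where `ω ≠ 0`, the
  -- denominator does not vanish.
  let lam : ℂ → ℂ := fun ζ => C.frame e'₁ e₁ ζ / (C.frame e'₂ e₂ (τ ζ) * deriv τ ζ)
  let W₁ : Set ℂ := (C.domain e'₁ e₁ ∩ C.domain e'₁ e₂) ∩
    (e'₁.target ∩ e'₁.symm ⁻¹' (id ⁻¹' e'₂.source))
  have hW₁ : IsOpen W₁ := (C.isOpen_domain.inter C.isOpen_domain).inter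
    (isOpen_coordDomain continuous_id e'₁ e'₂)
  let V : Bool → Set ℂ := fun i => cond i (W₁ ∩ C.omega.coeff e'₁ ⁻¹' {0}ᶜ)
    (C.domain e'₂ e₂ ∩ C.omega.coeff e'₂ ⁻¹' {0}ᶜ)
  have hVtrue : IsOpen (V true) :=
    (((C.contDiffOn_omega he'₁).continuousOn.mono fun ζ hζ => hζ.1.1.1).isOpen_inter_preimage
      hW₁ isOpen_compl_singleton)
  have hVfalse : IsOpen (V false) :=
    (((C.contDiffOn_omega he'₂).continuousOn.mono fun ζ hζ => hζ.1).isOpen_inter_preimage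
      C.isOpen_domain isOpen_compl_singleton)
  have hV : ∀ i, IsOpen (V i) := fun i => by cases i <;> assumption
  have hτ : DifferentiableOn ℂ τ (V true) :=
    (CMCUmbilic.differentiableOn_coord (f := id) contMDiff_id he'₁ he'₂).mono fun ζ hζ => hζ.1.2
  have hpt : ∀ ζ ∈ V true, ∃ x, x ∈ e'₁.source ∧ x ∈ e'₂.source ∧ C.proj x ∈ e₁.source ∧
      C.proj x ∈ e₂.source ∧ e'₁ x = ζ ∧ τ ζ = e'₂ x := fun ζ hζ =>
    ⟨e'₁.symm ζ, e'₁.map_target hζ.1.2.1, hζ.1.2.2, hζ.1.1.1.2, hζ.1.1.2.2,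
      e'₁.right_inv hζ.1.2.1, rfl⟩
  have hτ0 : ∀ ζ ∈ V true, deriv τ ζ ≠ 0 := by
    intro ζ hζ
    obtain ⟨x, h1, h2, -, -, rfl, -⟩ := hpt ζ hζ
    exact deriv_transition_ne_zero he'₁ he'₂ h1 h2
  have hωτ : ∀ ζ ∈ V true, C.omega.coeff e'₁ ζ = C.omega.coeff e'₂ (τ ζ) * deriv τ ζ := by
    intro ζ hζ
    obtain ⟨x, h1, h2, -, -, rfl, h3⟩ := hpt ζ hζ
    rw [h3]
    exact C.omega_transform he'₁ he'₂ h1 h2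
  have hmap : Set.MapsTo τ (V true) (V false) := by
    intro ζ hζ
    have hω := hωτ ζ hζ
    obtain ⟨x, h1, h2, -, h4, rfl, h3⟩ := hpt ζ hζ
    refine ⟨?_, fun h => hζ.2 ?_⟩
    · rw [h3]
      exact ⟨e'₂.map_source h2, by simpa [e'₂.left_inv h2] using h4⟩
    · rw [Set.mem_singleton_iff] at h ⊢
      rw [hω, h, zero_mul]
  have hg : ∀ i, ContDiffOn ℝ ∞ (cond i (C.frame e'₁ e₁) (C.frame e'₂ e₂)) (V i) := by
    rintro (_ | _)
    · exact (C.contDiffOn_frame he'₂ he₂).mono fun ζ hζ => hζ.1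
    · exact (C.contDiffOn_frame he'₁ he₁).mono fun ζ hζ => hζ.1.1.1
  have hg0 : ∀ i, ∀ ζ ∈ V i, cond i (C.frame e'₁ e₁) (C.frame e'₂ e₂) ζ ≠ 0 := by
    rintro (_ | _) ζ hζ
    · exact C.frame_ne_zero he'₂ he₂ hζ.1 hζ.2
    · exact C.frame_ne_zero he'₁ he₁ hζ.1.1.1 hζ.2
  have hom0 : ∀ i, ∀ ζ ∈ V i, cond i (C.omega.coeff e'₁) (C.omega.coeff e'₂) ζ ≠ 0 := by
    rintro (_ | _) ζ hζ
    exacts [hζ.2, hζ.2]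
  have hom : ∀ i, ContDiffOn ℝ ∞ (cond i (C.omega.coeff e'₁) (C.omega.coeff e'₂)) (V i) := by
    rintro (_ | _)
    · exact (C.contDiffOn_omega he'₂).mono fun ζ hζ => hζ.1.1
    · exact (C.contDiffOn_omega he'₁).mono fun ζ hζ => hζ.1.1.1.1
  have hq : ∀ i, ContDiffOn ℝ ∞ (cond i (C.root e'₁ e₁) (C.root e'₂ e₂)) (V i) := by
    rintro (_ | _)
    · exact contDiffOn_div (hom false) (hg false) (hg0 false)
    · exact contDiffOn_div (hom true) (hg true) (hg0 true)
  have hq0 : ∀ i, ∀ ζ ∈ V i, cond i (C.root e'₁ e₁) (C.root e'₂ e₂) ζ ≠ 0 := by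
    rintro (_ | _) ζ hζ
    · exact div_ne_zero (hom0 false ζ hζ) (hg0 false ζ hζ)
    · exact div_ne_zero (hom0 true ζ hζ) (hg0 true ζ hζ)
  have hden : ∀ ζ ∈ V true, C.frame e'₂ e₂ (τ ζ) * deriv τ ζ ≠ 0 := fun ζ hζ =>
    mul_ne_zero (hg0 false _ (hmap hζ)) (hτ0 ζ hζ)
  have hτr := contDiffOn_real_of_holomorphic hVtrue hτ
  have hl : ContDiffOn ℝ ∞ lam (V true) :=
    contDiffOn_div (hg true) (((hg false).comp hτr hmap).mul
      (contDiffOn_real_of_holomorphic hVtrue (hτ.deriv hVtrue))) hden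
  have hl1 : ∀ ζ ∈ V true, lam ζ * conj (lam ζ) = 1 := by
    intro ζ hζ
    have hd := hden ζ hζ
    obtain ⟨x, h1, h2, h3, h4, rfl, h5⟩ := hpt ζ hζ
    have h := C.frame_mul_conj_transform he'₁ he'₂ he₁ he₂ h1 h2 h3 h4
    rw [← h5] at h
    simp only [lam]
    rw [map_div₀, div_mul_div_comm, h]
    exact div_self (mul_ne_zero hd ((map_ne_zero _).mpr hd))
  have hgτ : ∀ ζ ∈ V true, C.frame e'₁ e₁ ζ = lam ζ * (C.frame e'₂ e₂ (τ ζ) * deriv τ ζ) :=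
    fun ζ hζ => (div_mul_cancel₀ _ (hden ζ hζ)).symm
  have hqτ : ∀ ζ ∈ V true, C.root e'₁ e₁ ζ = (lam ζ)⁻¹ * C.root e'₂ e₂ (τ ζ) := by
    intro ζ hζ
    have h1 := hg0 false _ (hmap hζ)
    have h2 := hg0 true _ hζ
    have h3 := hτ0 ζ hζ
    simp only [cond] at h1 h2
    simp only [root, lam]
    rw [hωτ ζ hζ]
    field_simp
  have hyV : e'₁ y ∈ V true :=
    ⟨⟨⟨⟨e'₁.map_source hy₁, by simpa [e'₁.left_inv hy₁] using hx₁⟩,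
      ⟨e'₁.map_source hy₁, by simpa [e'₁.left_inv hy₁] using hx₂⟩⟩,
      ⟨e'₁.map_source hy₁, by simpa [e'₁.left_inv hy₁] using hy₂⟩⟩, h0⟩
  have hmain := phi_comp hV hτ hτ0 hmap hl hl1 hg hg0 hgτ hq hq0 hqτ γ n hyV
  have hτy : τ (e'₁ y) = e'₂ y := by simp only [τ]; rw [e'₁.left_inv hy₁]
  rw [hτy] at hmain
  exact hmain

/-! ### The zeros of `ω` -/

/-- If `ω` vanished on an open set, that set would contain a point over a non-umbilic. Near it `ω² =
proj^* II` makes the projection locally constant, so distinct points lie over the same point and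
represent the same `κ`, contrary to uniqueness in `regular_bijective`. -/
theorem not_eventually_omega_eq_zero (he' : e' ∈ Charts Y) {ζ₀ : ℂ} (hζ₀ : ζ₀ ∈ e'.target) :
    ¬ ∀ᶠ ζ in 𝓝 ζ₀, C.omega.coeff e' ζ = 0 := by
  intro hev
  obtain ⟨W, hWsub, hW, hζW⟩ := mem_nhds_iff.mp
    (Filter.inter_mem hev (e'.open_target.mem_nhds hζ₀))
  obtain ⟨y₁, ⟨hy₁, hy₁W⟩, hreg⟩ := C.dense_regular.inter_open_nonempty _
    (e'.isOpen_inter_preimage hW)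
    ⟨e'.symm ζ₀, e'.map_target hζ₀, by rwa [Set.mem_preimage, e'.right_inv hζ₀]⟩
  simp only [Set.mem_ofPred_eq, Differential.VanishesAt, not_forall] at hreg
  obtain ⟨e, he, hx, hne⟩ := hreg
  have hdom : e' y₁ ∈ C.domain e' e :=
    ⟨e'.map_source hy₁, by simpa [e'.left_inv hy₁] using hx⟩
  have hcy : C.coord e' e (e' y₁) = e (C.proj y₁) := by rw [coord, e'.left_inv hy₁]
  have hcont : ContinuousAt (fun ζ => S.hopf.coeff e (C.coord e' e ζ)) (e' y₁) := by
    refine ContinuousAt.comp (f := C.coord e' e) (g := S.hopf.coeff e) ?_ ?_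
    · exact ((S.hopf_holomorphic e he).differentiableAt
        (e.open_target.mem_nhds (C.coord_mem_target hdom))).continuousAt
    · exact ((C.differentiableOn_coord he' he).differentiableAt
        (C.isOpen_domain.mem_nhds hdom)).continuousAt
  have hne' : ∀ᶠ ζ in 𝓝 (e' y₁), S.hopf.coeff e (C.coord e' e ζ) ≠ 0 :=
    hcont.eventually_ne (by rwa [hcy])
  obtain ⟨r, hr, hball⟩ := Metric.mem_nhds_iff.mp
    (Filter.inter_mem hne' (Filter.inter_mem (hW.mem_nhds hy₁W) (C.isOpen_domain.mem_nhds hdom)))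
  have hderiv : ∀ ζ ∈ Metric.ball (e' y₁) r, deriv (C.coord e' e) ζ = 0 := by
    intro ζ hζ
    obtain ⟨h1, h2, h3⟩ := hball hζ
    have h := C.omega_sq_coord he' he h3
    rw [show C.omega.coeff e' ζ = 0 from (hWsub h2).1, zero_pow two_ne_zero, eq_comm,
      mul_eq_zero, pow_eq_zero_iff two_ne_zero] at h
    exact h.resolve_left h1
  have hy₂m : e' y₁ + (r / 2 : ℝ) ∈ Metric.ball (e' y₁) r := by
    rw [Metric.mem_ball, dist_eq_norm, add_sub_cancel_left, Complex.norm_real, Real.norm_eq_abs,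
      abs_of_pos (half_pos hr)]
    exact half_lt_self hr
  have hconst : C.coord e' e (e' y₁ + (r / 2 : ℝ)) = C.coord e' e (e' y₁) :=
    Metric.isOpen_ball.is_const_of_deriv_eq_zero (convex_ball _ _).isPreconnected
      ((C.differentiableOn_coord he' he).mono fun ζ hζ => (hball hζ).2.2) hderiv hy₂m
      (Metric.mem_ball_self hr)
  have hd₂ := (hball hy₂m).2.2
  have hproj : C.proj (e'.symm (e' y₁ + (r / 2 : ℝ))) = C.proj y₁ :=
    e.injOn hd₂.2 hx (hconst.trans hcy)
  -- Any root will do: both `ω` and the derivative of the projection vanish at the points in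
  -- question, so the condition on `κ` reads `0 = κ * 0`.
  obtain ⟨κ, hκ⟩ := IsAlgClosed.exists_pow_nat_eq (S.hopf.coeff e (e (C.proj y₁))) two_pos
  have key : ∀ y, y ∈ e'.source → e' y ∈ Metric.ball (e' y₁) r → C.proj y = C.proj y₁ →
      C.proj y = C.proj y₁ ∧ ∀ e'' ∈ Charts Y, y ∈ e''.source →
        C.omega.coeff e'' (e'' y) = κ * deriv (fun ζ => e (C.proj (e''.symm ζ))) (e'' y) := by
    intro y hy hyB hpy
    refine ⟨hpy, fun e'' he'' hy'' => ?_⟩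
    have h0 : C.omega.coeff e'' (e'' y) = 0 := by
      rw [C.omega_transform he'' he' hy'' hy,
        show C.omega.coeff e' (e' y) = 0 from (hWsub (hball hyB).2.1).1, zero_mul]
    have hsq := C.omega_sq e'' he'' e he y hy'' (hpy ▸ hx)
    rw [h0, hpy, zero_pow two_ne_zero, eq_comm, mul_eq_zero, pow_eq_zero_iff two_ne_zero] at hsq
    rw [h0, hsq.resolve_left hne, mul_zero]
  have hreg' : ¬ S.hopf.VanishesAt (C.proj y₁) := fun h => hne (h e he hx)
  have heq := (C.regular_bijective _ hreg' e he hx κ hκ).unique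
    (key y₁ hy₁ (Metric.mem_ball_self hr) rfl)
    (key _ (e'.map_target hd₂.1) (by rwa [e'.right_inv hd₂.1]) hproj)
  have h := congrArg e' heq
  rw [e'.right_inv hd₂.1, left_eq_add, Complex.ofReal_eq_zero] at h
  exact (half_pos hr).ne' h

theorem eventually_omega_ne_zero (he' : e' ∈ Charts Y) {ζ₀ : ℂ} (hζ₀ : ζ₀ ∈ e'.target) :
    ∀ᶠ ζ in 𝓝[≠] ζ₀, C.omega.coeff e' ζ ≠ 0 :=
  (((C.omega_holomorphic e' he').analyticAt
    (e'.open_target.mem_nhds hζ₀)).eventually_eq_zero_or_eventually_ne_zero).resolve_left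
    (C.not_eventually_omega_eq_zero he' hζ₀)

/-! ### Local extension and gluing -/

/-- Locally, `φ_n ⊗ ω^{4n}` is the restriction of a smooth section. -/
theorem exists_local_extension (he' : e' ∈ Charts Y) (he : e ∈ Charts X) {ζ₀ : ℂ}
    (hζ₀ : ζ₀ ∈ C.domain e' e) (γ : ℂ) (n : ℕ) :
    ∃ V, IsOpen V ∧ ζ₀ ∈ V ∧ V ⊆ C.domain e' e ∧ ∃ s s' : ℂ → ℂ, ContDiffOn ℝ ∞ s V ∧
      ContDiffOn ℝ ∞ s' V ∧ ∀ ζ ∈ V, C.omega.coeff e' ζ ≠ 0 →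
        phiDz γ (C.frame e' e) (C.root e' e) n ζ * C.omega.coeff e' ζ ^ (4 * n) = s ζ ∧
        phiDzbar γ (C.frame e' e) (C.root e' e) n ζ * C.omega.coeff e' ζ ^ (4 * n) = s' ζ := by
  by_cases h0 : C.omega.coeff e' ζ₀ = 0
  · have hωan : AnalyticAt ℂ (C.omega.coeff e') ζ₀ :=
      (C.omega_holomorphic e' he').analyticAt (e'.open_target.mem_nhds hζ₀.1)
    have hNan : AnalyticAt ℂ (deriv (C.coord e' e)) ζ₀ :=
      ((C.differentiableOn_coord he' he).deriv C.isOpen_domain).analyticAt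
        (C.isOpen_domain.mem_nhds hζ₀)
    have hNne : ¬ ∀ᶠ ζ in 𝓝 ζ₀, deriv (C.coord e' e) ζ = 0 := fun h =>
      C.not_eventually_omega_eq_zero he' hζ₀.1 (by
        filter_upwards [h, C.isOpen_domain.mem_nhds hζ₀] with ζ h1 h2
        by_contra h3
        exact C.deriv_coord_ne_zero he' he h2 h3 h1)
    obtain ⟨m, c, hc, hc0, hω⟩ := hωan.exists_eventuallyEq_pow_smul_nonzero_iff.mpr
      (C.not_eventually_omega_eq_zero he' hζ₀.1)
    obtain ⟨l, d, hd, hd0, hN⟩ := hNan.exists_eventuallyEq_pow_smul_nonzero_iff.mpr hNne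
    obtain ⟨V, hVsub, hV, hζV⟩ := mem_nhds_iff.mp (Filter.inter_mem
      (Filter.inter_mem (hω.and hN) (hc.continuousAt.eventually_ne hc0))
      (Filter.inter_mem (Filter.inter_mem (hd.continuousAt.eventually_ne hd0)
        (hc.eventually_analyticAt.and hd.eventually_analyticAt)) (C.isOpen_domain.mem_nhds hζ₀)))
    have hm : 1 ≤ m := by
      rcases Nat.eq_zero_or_pos m with rfl | hm
      · have := hω.self_of_nhds
        rw [h0, pow_zero, one_smul] at this
        exact absurd this.symm hc0
      · exact hm
    have hVd : V ⊆ C.domain e' e := fun ζ hζ => (hVsub hζ).2.2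
    have hcV : ContDiffOn ℝ ∞ c V := contDiffOn_real_of_holomorphic hV fun ζ hζ =>
      (hVsub hζ).2.1.2.1.differentiableAt.differentiableWithinAt
    have hdV : ContDiffOn ℝ ∞ d V := contDiffOn_real_of_holomorphic hV fun ζ hζ =>
      (hVsub hζ).2.1.2.2.differentiableAt.differentiableWithinAt
    obtain ⟨s, s', hs, hs', h⟩ := exists_smooth_phi (t := fun ζ => ζ - ζ₀) (l := l) (m := m)
      (a := fun ζ => (Real.exp (S.u e (C.coord e' e ζ)) : ℂ) * d ζ) (c := c) (g := C.frame e' e)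
      (q := C.root e' e) (om := C.omega.coeff e') hV
      (differentiableOn_id.sub (differentiableOn_const _))
      (((C.contDiffOn_exp_u he' he).mono hVd).mul hdV)
      (fun ζ hζ => mul_ne_zero (Complex.ofReal_ne_zero.mpr (Real.exp_ne_zero _))
        (hVsub hζ).2.1.1)
      (fun ζ hζ => by
        have h := (hVsub hζ).1.1.2
        rw [smul_eq_mul] at h
        rw [frame, h]
        ring) hcV (fun ζ hζ => (hVsub hζ).1.2) (fun ζ hζ => (hVsub hζ).1.1.1)
      (fun ζ hζ => rfl) (Or.inl hm) γ n
    refine ⟨V, hV, hζV, hVd, s, s', hs, hs', fun ζ hζ hωζ => h ζ hζ fun ht => hωζ ?_⟩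
    have h := (hVsub hζ).1.1.1
    rwa [ht, zero_pow (by omega), zero_smul] at h
  -- Where `ω` has no zero the same lemma applies with the trivial factor `t = 1`, as `ξ` has no
  -- zero there either.
  · let V : Set ℂ := C.domain e' e ∩ C.omega.coeff e' ⁻¹' {0}ᶜ
    have hV : IsOpen V := ((C.contDiffOn_omega he').continuousOn.mono
      Set.inter_subset_left).isOpen_inter_preimage C.isOpen_domain isOpen_compl_singleton
    obtain ⟨s, s', hs, hs', h⟩ := exists_smooth_phi (V := V) (t := fun _ => 1) (l := 0) (m := 0)
      (a := C.frame e' e) (c := C.omega.coeff e') (g := C.frame e' e)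
      (q := C.root e' e) (om := C.omega.coeff e') hV (differentiableOn_const _)
      ((C.contDiffOn_frame he' he).mono fun ζ hζ => hζ.1)
      (fun ζ hζ => C.frame_ne_zero he' he hζ.1 hζ.2) (fun ζ hζ => by simp)
      ((C.contDiffOn_omega he').mono fun ζ hζ => hζ.1.1) (fun ζ hζ => hζ.2)
      (fun ζ hζ => by simp) (fun ζ hζ => rfl) (Or.inr fun ζ hζ => rfl) γ n
    exact ⟨V, hV, ⟨hζ₀, h0⟩, fun ζ hζ => hζ.1, s, s', hs, hs', fun ζ hζ _ => h ζ hζ one_ne_zero⟩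

/-- A section which is defined away from the zeros of `ω` and which has local smooth extensions
extends to a smooth section. -/
theorem exists_smooth_differential {r k : ℕ} (F : OpenPartialHomeomorph Y ℂ → ℂ → ℂ)
    (hloc : ∀ e' ∈ Charts Y, ∀ ζ₀ ∈ e'.target, ∃ V, IsOpen V ∧ ζ₀ ∈ V ∧ V ⊆ e'.target ∧
      ∃ s : ℂ → ℂ, ContDiffOn ℝ ∞ s V ∧ ∀ ζ ∈ V, C.omega.coeff e' ζ ≠ 0 → F e' ζ = s ζ)
    (htrans : ∀ e'₁ ∈ Charts Y, ∀ e'₂ ∈ Charts Y, ∀ y ∈ e'₁.source, y ∈ e'₂.source →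
      C.omega.coeff e'₁ (e'₁ y) ≠ 0 → F e'₁ (e'₁ y) = F e'₂ (e'₂ y) *
        deriv (fun z => e'₂ (e'₁.symm z)) (e'₁ y) ^ r *
        conj (deriv (fun z => e'₂ (e'₁.symm z)) (e'₁ y)) ^ k) :
    ∃ D : Differential Y r k, D.IsSmooth ∧ ∀ e' ∈ Charts Y, ∀ y ∈ e'.source,
      C.omega.coeff e' (e' y) ≠ 0 → D.coeff e' (e' y) = F e' (e' y) := by
  -- Punctured limits give a choice-free value at every point: the zeros of `ω` are isolated, so the
  -- limit exists and equals any local smooth extension.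
  let E : OpenPartialHomeomorph Y ℂ → ℂ → ℂ := fun e' ζ => Filter.limUnder (𝓝[≠] ζ) (F e')
  have hE : ∀ e' ∈ Charts Y, ∀ ζ₀ ∈ e'.target, ∃ V, IsOpen V ∧ ζ₀ ∈ V ∧
      ∃ s : ℂ → ℂ, ContDiffOn ℝ ∞ s V ∧ (∀ ζ ∈ V, E e' ζ = s ζ) ∧
        ∀ ζ ∈ V, C.omega.coeff e' ζ ≠ 0 → F e' ζ = s ζ := by
    intro e' he' ζ₀ hζ₀
    obtain ⟨V, hV, hζV, hVt, s, hs, h⟩ := hloc e' he' ζ₀ hζ₀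
    refine ⟨V, hV, hζV, s, hs, fun ζ hζ => Filter.Tendsto.limUnder_eq ?_, h⟩
    have hsc : Filter.Tendsto s (𝓝[≠] ζ) (𝓝 (s ζ)) :=
      (hs.continuousOn.continuousAt (hV.mem_nhds hζ)).mono_left nhdsWithin_le_nhds
    refine hsc.congr' ?_
    filter_upwards [C.eventually_omega_ne_zero he' (hVt hζ),
      nhdsWithin_le_nhds (hV.mem_nhds hζ)] with ξ h1 h2
    exact (h ξ h2 h1).symm
  have hsmooth : ∀ e' ∈ Charts Y, ContDiffOn ℝ ∞ (E e') e'.target := by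
    intro e' he' ζ₀ hζ₀
    obtain ⟨V, hV, hζV, s, hs, h1, -⟩ := hE e' he' ζ₀ hζ₀
    exact ((hs.congr h1).contDiffAt (hV.mem_nhds hζV)).contDiffWithinAt
  have heq : ∀ e' ∈ Charts Y, ∀ ζ ∈ e'.target, C.omega.coeff e' ζ ≠ 0 → E e' ζ = F e' ζ := by
    intro e' he' ζ hζ h0
    obtain ⟨V, hV, hζV, s, hs, h1, h2⟩ := hE e' he' ζ hζ
    rw [h1 ζ hζV, h2 ζ hζV h0]
  have hcontE : ∀ e' ∈ Charts Y, ∀ ζ ∈ e'.target, ContinuousAt (E e') ζ := fun e' he' ζ hζ =>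
    (hsmooth e' he').continuousOn.continuousAt (e'.open_target.mem_nhds hζ)
  refine ⟨⟨E, ?_⟩, hsmooth, fun e' he' y hy h0 => heq e' he' _ (e'.map_source hy) h0⟩
  intro e'₁ he'₁ e'₂ he'₂ y hy₁ hy₂
  let τ : ℂ → ℂ := fun z => e'₂ (e'₁.symm z)
  let W : Set ℂ := e'₁.target ∩ e'₁.symm ⁻¹' (id ⁻¹' e'₂.source)
  have hW : IsOpen W := isOpen_coordDomain continuous_id e'₁ e'₂
  have hyW : e'₁ y ∈ W :=
    ⟨e'₁.map_source hy₁, by simpa [e'₁.left_inv hy₁] using hy₂⟩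
  have hτ : DifferentiableOn ℂ τ W :=
    CMCUmbilic.differentiableOn_coord (f := id) contMDiff_id he'₁ he'₂
  have hτc : ContinuousAt τ (e'₁ y) := (hτ.differentiableAt (hW.mem_nhds hyW)).continuousAt
  have hτ'c : ContinuousAt (deriv τ) (e'₁ y) :=
    ((hτ.deriv hW).differentiableAt (hW.mem_nhds hyW)).continuousAt
  have hτy : τ (e'₁ y) = e'₂ y := by simp only [τ]; rw [e'₁.left_inv hy₁]
  have hEτ : ContinuousAt (fun ζ => E e'₂ (τ ζ)) (e'₁ y) :=
    ContinuousAt.comp (f := τ) (g := E e'₂)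
      (hτy ▸ hcontE e'₂ he'₂ _ (e'₂.map_source hy₂)) hτc
  have hR : ContinuousAt (fun ζ => E e'₂ (τ ζ) * deriv τ ζ ^ r * conj (deriv τ ζ) ^ k) (e'₁ y) :=
    (hEτ.mul (hτ'c.pow r)).mul ((Complex.continuous_conj.continuousAt.comp hτ'c).pow k)
  have hLt := (hcontE e'₁ he'₁ _ (e'₁.map_source hy₁)).tendsto.mono_left
    (nhdsWithin_le_nhds (s := {e'₁ y}ᶜ))
  have hRt := hR.tendsto.mono_left (nhdsWithin_le_nhds (s := {e'₁ y}ᶜ))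
  -- The transformation rule holds off the zeros of `ω`; both sides are continuous, so it passes to
  -- the limit.
  have hev : E e'₁ =ᶠ[𝓝[≠] (e'₁ y)]
      fun ζ => E e'₂ (τ ζ) * deriv τ ζ ^ r * conj (deriv τ ζ) ^ k := by
    filter_upwards [C.eventually_omega_ne_zero he'₁ (e'₁.map_source hy₁),
      nhdsWithin_le_nhds (hW.mem_nhds hyW)] with ζ h0 hζ
    have hs₁ := e'₁.map_target hζ.1
    have hs₂ : e'₁.symm ζ ∈ e'₂.source := hζ.2
    have hr := e'₁.right_inv hζ.1
    have hω := C.omega_transform he'₁ he'₂ hs₁ hs₂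
    have ht := htrans e'₁ he'₁ e'₂ he'₂ _ hs₁ hs₂ (by rwa [hr])
    rw [hr] at hω ht
    have h0' : C.omega.coeff e'₂ (τ ζ) ≠ 0 := fun h => h0 (by rw [hω, h, zero_mul])
    rw [heq e'₁ he'₁ ζ hζ.1 h0, heq e'₂ he'₂ (τ ζ) (e'₂.map_source hs₂) h0']
    exact ht
  have := tendsto_nhds_unique (hLt.congr' hev) hRt
  rw [hτy] at this
  exact this

/-- `φ_n ⊗ ω^{4n}` is a smooth section of `Ω¹ ⊗ K^{4n}`. -/
theorem exists_smooth_section [IsManifold 𝓘(ℂ) ω X] (γ : ℂ) (n : ℕ) :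
    ∃ σ : TwistedOneForm Y (4 * n), σ.IsSmooth ∧
      ∀ e' ∈ Charts Y, ∀ e ∈ Charts X, ∀ y ∈ e'.source, C.proj y ∈ e.source →
        C.omega.coeff e' (e' y) ≠ 0 →
        σ.dzPart.coeff e' (e' y) = phiDz γ (C.frame e' e) (C.root e' e) n (e' y) *
          C.omega.coeff e' (e' y) ^ (4 * n) ∧
        σ.dzbarPart.coeff e' (e' y) = phiDzbar γ (C.frame e' e) (C.root e' e) n (e' y) *
          C.omega.coeff e' (e' y) ^ (4 * n) := by
  -- The chart of the surface varies with the point, so smoothness of `F` is not apparent. `hindep`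
  -- repairs this: where `ω ≠ 0`, any fixed chart gives the same value.
  let ch : OpenPartialHomeomorph Y ℂ → ℂ → OpenPartialHomeomorph X ℂ := fun e' ζ =>
    chartAt ℂ (C.proj (e'.symm ζ))
  have hch : ∀ e' ζ, ch e' ζ ∈ Charts X := fun e' ζ =>
    IsManifold.chart_mem_maximalAtlas (C.proj (e'.symm ζ))
  have hchs : ∀ e' : OpenPartialHomeomorph Y ℂ, ∀ y ∈ e'.source,
      C.proj y ∈ (ch e' (e' y)).source := fun e' y hy => by
    simp only [ch]
    rw [e'.left_inv hy]
    exact mem_chart_source ℂ _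
  let F : OpenPartialHomeomorph Y ℂ → ℂ → ℂ := fun e' ζ =>
    phiDz γ (C.frame e' (ch e' ζ)) (C.root e' (ch e' ζ)) n ζ * C.omega.coeff e' ζ ^ (4 * n)
  let F' : OpenPartialHomeomorph Y ℂ → ℂ → ℂ := fun e' ζ =>
    phiDzbar γ (C.frame e' (ch e' ζ)) (C.root e' (ch e' ζ)) n ζ * C.omega.coeff e' ζ ^ (4 * n)
  have hindep : ∀ e' ∈ Charts Y, ∀ e ∈ Charts X, ∀ y ∈ e'.source, C.proj y ∈ e.source →
      C.omega.coeff e' (e' y) ≠ 0 →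
      F e' (e' y) = phiDz γ (C.frame e' e) (C.root e' e) n (e' y) *
          C.omega.coeff e' (e' y) ^ (4 * n) ∧
      F' e' (e' y) = phiDzbar γ (C.frame e' e) (C.root e' e) n (e' y) *
          C.omega.coeff e' (e' y) ^ (4 * n) := by
    intro e' he' e he y hy hx h0
    have h := C.phi_transform he' he' (hch e' (e' y)) he hy hy (hchs e' y hy) hx h0 γ n
    rw [deriv_coord_self hy, map_one, mul_one, mul_one] at h
    exact ⟨by simp only [F]; rw [h.1], by simp only [F']; rw [h.2]⟩
  have hloc : ∀ e' ∈ Charts Y, ∀ ζ₀ ∈ e'.target, ∃ V, IsOpen V ∧ ζ₀ ∈ V ∧ V ⊆ e'.target ∧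
      ∃ s s' : ℂ → ℂ, ContDiffOn ℝ ∞ s V ∧ ContDiffOn ℝ ∞ s' V ∧
        ∀ ζ ∈ V, C.omega.coeff e' ζ ≠ 0 → F e' ζ = s ζ ∧ F' e' ζ = s' ζ := by
    intro e' he' ζ₀ hζ₀
    obtain ⟨V, hV, hζV, hVd, s, s', hs, hs', h⟩ := C.exists_local_extension he' (hch e' ζ₀)
      ⟨hζ₀, mem_chart_source ℂ _⟩ γ n
    refine ⟨V, hV, hζV, fun ζ hζ => (hVd hζ).1, s, s', hs, hs', fun ζ hζ h0 => ?_⟩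
    have hr := e'.right_inv (hVd hζ).1
    have hi := hindep e' he' (ch e' ζ₀) (hch e' ζ₀) _ (e'.map_target (hVd hζ).1) (hVd hζ).2
      (by rwa [hr])
    rw [hr] at hi
    exact ⟨hi.1.trans (h ζ hζ h0).1, hi.2.trans (h ζ hζ h0).2⟩
  obtain ⟨D, hD, hDF⟩ := C.exists_smooth_differential (r := 4 * n + 1) (k := 0) F
    (fun e' he' ζ₀ hζ₀ => by
      obtain ⟨V, hV, hζV, hVt, s, s', hs, hs', h⟩ := hloc e' he' ζ₀ hζ₀
      exact ⟨V, hV, hζV, hVt, s, hs, fun ζ hζ h0 => (h ζ hζ h0).1⟩)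
    (fun e'₁ he'₁ e'₂ he'₂ y hy₁ hy₂ h0 => by
      have h := C.phi_transform he'₁ he'₂ (hch e'₁ (e'₁ y)) (hch e'₂ (e'₂ y)) hy₁ hy₂
        (hchs e'₁ y hy₁) (hchs e'₂ y hy₂) h0 γ n
      simp only [F]
      rw [h.1, C.omega_transform he'₁ he'₂ hy₁ hy₂]
      ring)
  obtain ⟨D', hD', hDF'⟩ := C.exists_smooth_differential (r := 4 * n) (k := 1) F'
    (fun e' he' ζ₀ hζ₀ => by
      obtain ⟨V, hV, hζV, hVt, s, s', hs, hs', h⟩ := hloc e' he' ζ₀ hζ₀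
      exact ⟨V, hV, hζV, hVt, s', hs', fun ζ hζ h0 => (h ζ hζ h0).2⟩)
    (fun e'₁ he'₁ e'₂ he'₂ y hy₁ hy₂ h0 => by
      have h := C.phi_transform he'₁ he'₂ (hch e'₁ (e'₁ y)) (hch e'₂ (e'₂ y)) hy₁ hy₂
        (hchs e'₁ y hy₁) (hchs e'₂ y hy₂) h0 γ n
      simp only [F']
      rw [h.2, C.omega_transform he'₁ he'₂ hy₁ hy₂]
      ring)
  refine ⟨⟨D, D'⟩, ⟨hD, hD'⟩, fun e' he' e he y hy hx h0 => ?_⟩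
  have hi := hindep e' he' e he y hy hx h0
  exact ⟨(hDF e' he' y hy h0).trans hi.1, (hDF' e' he' y hy h0).trans hi.2⟩

end DoubleCover

end CMCUmbilic

end

theorem mainTheorem10 (ε δ : ℝ) (hγ : ε + δ ^ 2 ≠ 0) :
    -- normal forms at an umbilic of degree `p`, in an adapted coordinate `z = w²`
    (∀ p n : ℕ, 1 ≤ p →
      ∃ Pa Pb Pc F G : CMCUmbilic.WPoly,
        Pa.IsO (4 * n - 2) ∧ Pb.IsO (4 * n - 4) ∧ Pc.IsO (4 * n - 4) ∧
        F.IsO (4 * n) ∧ G.IsO (4 * n - 4) ∧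
        ∀ (X : Type*) [TopologicalSpace X] [T2Space X] [ChartedSpace ℂ X]
          [IsManifold 𝓘(ℂ) ω X] (S : CMCUmbilic.CMCSurface ε δ X)
          (e : OpenPartialHomeomorph X ℂ), S.IsAdapted p e →
          ∀ w : ℂ, w ≠ 0 → w ^ 2 ∈ e.target →
            let γ := CMCUmbilic.gammaConst ε δ
            let g := CMCUmbilic.umbilicFrame (S.u e)
            let q := CMCUmbilic.umbilicRoot p (S.u e)
            (1 ≤ n →
              (CMCUmbilic.killing γ g q n).b w =
                  w ^ (-((2 * n - 1) * p + (4 * n - 4) : ℤ)) * Pb.value (S.u e) w ∧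
              (CMCUmbilic.killing γ g q n).c w =
                  w ^ (-((2 * n - 3) * p + (4 * n - 4) : ℤ)) * Pc.value (S.u e) w ∧
              (CMCUmbilic.killing γ g q n).a w =
                  w ^ (-((2 * n - 1) * p + (4 * n - 2) : ℤ)) * Pa.value (S.u e) w) ∧
            CMCUmbilic.phiDz γ g q n w =
                w ^ (-((2 * n - 1) * p + (4 * n - 1) : ℤ)) * F.value (S.u e) w ∧
            CMCUmbilic.phiDzbar γ g q n w =
                w ^ (-((2 * n - 1) * p + (4 * n - 4) : ℤ)) * G.value (S.u e) w *
                  (starRingEnd ℂ) w) ∧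
    -- `φ_n ⊗ ω^{4n}` is a smooth section of `Ω¹ ⊗ K^{4n}` on the double cover
    (∀ (n : ℕ) (X : Type*) [TopologicalSpace X] [T2Space X] [ChartedSpace ℂ X]
      [IsManifold 𝓘(ℂ) ω X] (S : CMCUmbilic.CMCSurface ε δ X)
      (Y : Type*) [TopologicalSpace Y] [T2Space Y] [ChartedSpace ℂ Y]
      [IsManifold 𝓘(ℂ) ω Y] (C : CMCUmbilic.DoubleCover S Y),
      ∃ σ : CMCUmbilic.TwistedOneForm Y (4 * n), σ.IsSmooth ∧
        ∀ e' ∈ CMCUmbilic.Charts Y, ∀ e ∈ CMCUmbilic.Charts X, ∀ y ∈ e'.source,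
          C.proj y ∈ e.source → C.omega.coeff e' (e' y) ≠ 0 →
            let γ := CMCUmbilic.gammaConst ε δ
            -- the coordinate `z = e` of the surface as a function of the coordinate `ζ = e'`
            let N : ℂ → ℂ := fun ζ => e (C.proj (e'.symm ζ))
            -- `ξ = e^u dz = g dζ` and `ω = h₂^{1/2} ξ`
            let g : ℂ → ℂ := fun ζ => (Real.exp (S.u e (N ζ)) : ℂ) * deriv N ζ
            let q : ℂ → ℂ := fun ζ => C.omega.coeff e' ζ / g ζ
            σ.dzPart.coeff e' (e' y) =
                CMCUmbilic.phiDz γ g q n (e' y) * C.omega.coeff e' (e' y) ^ (4 * n) ∧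
            σ.dzbarPart.coeff e' (e' y) =
                CMCUmbilic.phiDzbar γ g q n (e' y) * C.omega.coeff e' (e' y) ^ (4 * n)) := by
  refine ⟨fun p n _ => ?_, fun n X _ _ _ _ S Y _ _ _ _ C => ?_⟩
  · obtain ⟨Pa, Pb, Pc, F, G, ha, hb, hc, hF, hG, h⟩ :=
      CMCUmbilic.exists_normalForm (CMCUmbilic.gammaConst ε δ) p n
    exact ⟨Pa, Pb, Pc, F, G, ha, hb, hc, hF, hG, fun X _ _ _ _ S e he w hw hwe =>
      h (S.u e) e.target e.open_target (S.contDiffOn_u he.1) w hw hwe⟩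
  -- The local `N`, `g`, `q` of the statement are `coord`, `frame` and `root` by definition.
  · exact C.exists_smooth_section (CMCUmbilic.gammaConst ε δ) n
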